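/- **Setting.** A tuple $(\mathcal X,\mathcal Y,\mathcal Z,\mathcal H,\ell)$ consists of sets $\mathcal X,\mathcal Y$, a measurable space $\mathcal Z$ (with set $\Pi(\mathcal Z)$ of probability measures), a nonempty class $\mathcal H\subseteq\mathcal Z^{\mathcal X}$, and a loss $\ell:\mathcal Y\times\mathcal Z\to[0,c]$, where $0<c<\infty$ is fixed and each $\ell(y,\cdot)$ is measurable. A (randomized) online learner is a map $\mathcal A:(\mathcal X\times\mathcal Y)^\star\times\mathcal X\to\Pi(\mathcal Z)$. On a stream $(x_1,y_1),\dots,(x_T,y_T)$ it uses $\mu_t=\mathcal A((x_i,y_i)_{i<t},x_t)$ in round $t$, and its expected regret is $$\sum_{t=1}^T\mathbb E_{z\sim\mu_t}[\ell(y_t,z)]-\inf_{h\in\mathcal H}\sum_{t=1}^T\ell(y_t,h(x_t)).$$ (Since $\mu_t$ is determined by $(x_i,y_i)_{i<t}$ and $x_t$, the stream may be chosen by an adversary who sees $\mu_t$ before choosing $y_t$.) $\mathcal H$ is online learnable if there are one learner and a nonnegative, nondecreasing $R:\mathbb N\to\mathbb R$ with $R(T)/T\to0$ such that for all $T$ the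 expected regret on every stream of length $T$ is at most $R(T)$. For $\gamma>0$, a depth-$d$ tree is $\gamma$-shattered by $\mathcal H$ if there are node labels $\mathcal T_t:\Pi(\mathcal Z)^{t-1}\to\mathcal X$ and edge labels $f_t:\Pi(\mathcal Z)^t\to\mathcal Y$, $t=1,\dots,d$, such that for every $(\mu_1,\dots,\mu_d)\in\Pi(\mathcal Z)^d$ there is $h\in\mathcal H$ with $$\mathbb E_{z\sim\mu_t}[\ell(f_t(\mu_{\le t}),z)]\ \ge\ \ell(f_t(\mu_{\le t}),h(\mathcal T_t(\mu_{<t})))+\gamma\qquad(1\le t\le d).$$ $\mathrm{SMdim}_\gamma(\mathcal H)\in\mathbb N\cup\{\infty\}$ is the largest depth of a $\gamma$-shattered tree ($\infty$ if there are such trees of arbitrarily large depth). Put $$U_T=\inf_{\gamma>0}\Big\{c\,\mathrm{SMdim}_\gamma(\mathcal H)+\gamma T+1+2c\sqrt{\mathrm{SMdim}_\gamma(\mathcal H)\,T\ln(2cT)}\Big\},\qquad L=\sup_{\gamma>0}\gamma\,\mathrm{SMdim}_\gamma(\mathcal H)\in[0,\infty],$$ where the expression in braces is $\infty$ if $\mathrm{SMdim}_\gamma(\mathcal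 H)=\infty$, and the square root of a negative number is read as $0$. **Theorem (Agnostic Learnability).** (i) For every tuple and every horizon $T\ge1$ there is an online learner whose expected regret on every stream of length $T$ is at most $U_T$. This is tight up to a logarithmic factor in $T$: there is an absolute constant $C>0$ such that for every $d\ge1$ there is a tuple with $\mathcal Y=\mathcal Z=[-1,1]$, $\ell(y,z)=|y-z|$, $c=2$ and $\sup_{\gamma>0}\mathrm{SMdim}_\gamma(\mathcal H)=d$ such that, for every $T\ge\max(2,d)$, every online learner has on some stream of length $T$ an expected regret $\rho$ with $U_T\le C\,\ln(T)\,\rho$. (ii) Suppose $\sup_{\gamma>0}\mathrm{SMdim}_\gamma(\mathcal H)>0$. Then for every online learner the supremum of its expected regret over all nonempty streams is at least $L$; more precisely, for every $r<L$ some nonempty stream gives expected regret greater than $r$, and for every $\gamma>0$ and every natural number $n\le\mathrm{SMdim}_\gamma(\mathcal H)$ some stream of length $n$ gives expected regret at least $\gamma n$ (so a single stream gives at least $L$ whenever $L$ is finite and the supremum defining it is attained). This bound cannot be improved in general: for every $d\ge1$ there is a tuple with $\sup_{\gamma>0}\mathrm{SMdim}_\gamma(\mathcal H)=d$ and $L<\infty$,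 and an online learner whose expected regret on every stream, of any length, is at most $L$. (iii) For every tuple, $\mathcal H$ is online learnable if and only if $\mathrm{SMdim}_\gamma(\mathcal H)<\infty$ for every $\gamma>0$. -/

import Mathlib

open MeasureTheory Filter Topology
open scoped ENNReal

/-- A tuple `(X, Y, Z, H, ℓ)`: instance space `X`, label space `Y`, measurable prediction space `Z`,
a nonempty hypothesis class `H ⊆ Z ^ X`, and a loss `ℓ : Y × Z → ℝ≥0` bounded by a constant
`c > 0`. Nothing else is required of the loss, except that `ℓ (y, ·)` is measurable so that
expectations over predictions make sense. -/
structure LearningProblem (X Y Z : Type*) [MeasurableSpace Z] where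
  /-- the hypothesis class -/
  H : Set (X → Z)
  /-- the loss; the first argument is the label, the second one the prediction -/
  loss : Y → Z → ℝ
  /-- the bound on the loss -/
  c : ℝ
  H_nonempty : H.Nonempty
  loss_measurable : ∀ y, Measurable (loss y)
  loss_nonneg : ∀ y z, 0 ≤ loss y z
  c_pos : 0 < c
  loss_le : ∀ y z, loss y z ≤ c

/-- A (randomized) online learner: a deterministic map from the list of past labeled examples
(oldest first) and the new instance to a probability measure on the prediction space, from which
the prediction is drawn. -/
abbrev OnlineLearner (X Y Z : Type*) [MeasurableSpace Z] :=
  List (X × Y) → X → ProbabilityMeasure Z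

/-- The examples of a stream that come strictly before round `t`. -/
def history {X Y : Type*} {T : ℕ} (s : Fin T → X × Y) (t : Fin T) : List (X × Y) :=
  List.ofFn fun i : Fin t.val => s (Fin.castLE t.isLt.le i)

namespace LearningProblem

variable {X Y Z : Type*} [MeasurableSpace Z] (P : LearningProblem X Y Z)

/-- The expected loss `𝔼_{z ∼ μ} [ℓ (y, z)]`. -/
noncomputable def expLoss (y : Y) (μ : ProbabilityMeasure Z) : ℝ :=
  ∫ z, P.loss y z ∂(μ : Measure Z)

/-- The expected regret of the learner `A` on the stream `s` of length `T`: the expected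
cumulative loss minus the cumulative loss of the best hypothesis in hindsight. The measure that
`A` uses in a round is a function of the preceding examples and of the current instance, so an
adversary that chooses the label after seeing this measure also produces such a stream. -/
noncomputable def expRegret (A : OnlineLearner X Y Z) {T : ℕ} (s : Fin T → X × Y) : ℝ :=
  ∑ t, P.expLoss (s t).2 (A (history s t) (s t).1)
    - ⨅ h : P.H, ∑ t, P.loss (s t).2 (h.1 (s t).1)

/-- `H` `γ`-shatters some complete `X`-valued tree of depth `d` whose edges are indexed by the
probability measures on `Z`. Rounds are numbered from `0`: the node labels are
`tree t : Π(Z) ^ t → X`, the edge labels are `f t : Π(Z) ^ (t + 1) → Y`. -/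
def Shatters (γ : ℝ) (d : ℕ) : Prop :=
  ∃ (tree : (t : Fin d) → (Fin t.val → ProbabilityMeasure Z) → X)
    (f : (t : Fin d) → (Fin (t.val + 1) → ProbabilityMeasure Z) → Y),
    ∀ μ : Fin d → ProbabilityMeasure Z, ∃ h ∈ P.H, ∀ t : Fin d,
      P.loss (f t fun i => μ (Fin.castLE t.isLt i))
          (h (tree t fun i => μ (Fin.castLE t.isLt.le i))) + γ
        ≤ P.expLoss (f t fun i => μ (Fin.castLE t.isLt i)) (μ t)

/-- The sequential minimax dimension at scale `γ`: the largest depth of a `γ`-shattered tree, and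
`⊤` if there are `γ`-shattered trees of arbitrarily large depth. -/
noncomputable def SMdim (γ : ℝ) : ℕ∞ :=
  ⨆ (d : ℕ) (_ : P.Shatters γ d), (d : ℕ∞)

/-- `inf_{γ > 0} { c d_γ + γ T + 1 + 2 c √(d_γ T ln (2 c T)) }` with `d_γ = SMdim γ`; scales with
`SMdim γ = ⊤` contribute `⊤`, that is, they do not take part in the infimum. -/
noncomputable def upperBound (T : ℕ) : EReal :=
  ⨅ (γ : ℝ) (_ : 0 < γ) (d : ℕ) (_ : P.SMdim γ = d),
    ((P.c * d + γ * T + 1 + 2 * P.c * Real.sqrt (d * T * Real.log (2 * P.c * T)) : ℝ) : EReal)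

/-- `sup_{γ > 0} γ * SMdim γ`, possibly infinite. -/
noncomputable def lowerBound : ℝ≥0∞ :=
  ⨆ (γ : ℝ) (_ : 0 < γ), ENNReal.ofReal γ * (P.SMdim γ : ℝ≥0∞)

/-- Agnostic online learnability: one learner has, on all streams of length `T` and for all `T`,
expected regret at most `R T` for some nonnegative, nondecreasing, sublinear `R`. -/
def OnlineLearnable : Prop :=
  ∃ (A : OnlineLearner X Y Z) (R : ℕ → ℝ), (∀ T, 0 ≤ R T) ∧ Monotone R ∧
    Tendsto (fun T : ℕ => R T / T) atTop (𝓝 0) ∧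
    ∀ (T : ℕ) (s : Fin T → X × Y), P.expRegret A s ≤ R T

end LearningProblem

/-! `SMdim` is the value of a game. On a shattered tree the adversary descends along the learner's
own measures, and some hypothesis then beats the learner by γ in every round
(`TreeShatters.exists_stream`). This gives the dimension-based lower bounds, and sublinear regret
therefore forces finite dimension.

Conversely, if depth d + 1 is not shattered, then at each instance some measure is such that, for
every label, the hypotheses beating it by γ fail to shatter depth d. For a fixed hypothesis h,
shrink the version space exactly when h beats the measure: this happens at most d times, at cost at
most c each, and every other round costs at most γ more than h (`exists_experts`). Since these
rounds are unknown, each set of rounds is an expert, and exponential weights with a prior favouring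
small sets compete with all of them (`exists_expWeights_learner`). Choosing γ per horizon and
restarting at perfect squares yields one learner for all horizons (`expRegret_restart_le`).

The two sharpness examples have independent points as instances, so their dimension is the number of
points (`TreeShatters.le_card`, `treeShatters_card`). In `signClass`, random signs would force
regret of order √(T/d) per point; `exists_adversary` derandomizes this with a fourth-moment
potential. In `cheapMistakes`, a majority vote has regret at most 1/2 per point, by the potential
argument in `cumLoss_majority_le`. -/

namespace LearningProblem

variable {X Y Z : Type*} [MeasurableSpace Z] (P : LearningProblem X Y Z)

/-! ### Shattering, defined by recursion on the depth -/

/-- The hypotheses in `V` that beat `μ` by `γ` on the example `(x, y)`. -/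
def improving (γ : ℝ) (V : Set (X → Z)) (x : X) (y : Y) (μ : ProbabilityMeasure Z) :
    Set (X → Z) :=
  {h | h ∈ V ∧ P.loss y (h x) + γ ≤ P.expLoss y μ}

/-- `V` shatters a tree of depth `n` at scale `γ`, by recursion on the root of the tree. -/
def TreeShatters (γ : ℝ) : ℕ → Set (X → Z) → Prop
  | 0, V => V.Nonempty
  | n + 1, V => ∃ x, ∀ μ, ∃ y, TreeShatters γ n (P.improving γ V x y μ)

/-- The relation `LearningProblem.Shatters` for an arbitrary class `V`. -/
def ShattersOn (V : Set (X → Z)) (γ : ℝ) (d : ℕ) : Prop :=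
  ∃ (tree : (t : Fin d) → (Fin t.val → ProbabilityMeasure Z) → X)
    (f : (t : Fin d) → (Fin (t.val + 1) → ProbabilityMeasure Z) → Y),
    ∀ μ : Fin d → ProbabilityMeasure Z, ∃ h ∈ V, ∀ t : Fin d,
      P.loss (f t fun i => μ (Fin.castLE t.isLt i))
          (h (tree t fun i => μ (Fin.castLE t.isLt.le i))) + γ
        ≤ P.expLoss (f t fun i => μ (Fin.castLE t.isLt i)) (μ t)

lemma cons_castLE {α : Type*} {n m : ℕ} (h : m ≤ n) (a : α) (v : Fin n → α) :
    (fun i : Fin (m + 1) => (Fin.cons a v : Fin (n + 1) → α) (Fin.castLE (Nat.succ_le_succ h) i))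
      = Fin.cons a (fun i => v (Fin.castLE h i)) := by
  funext i
  refine Fin.cases ?_ (fun j => ?_) i <;> rfl

/-- The subtree below the root edge μ has the labels of the whole tree with μ prepended to each
path; conversely, chosen subtrees are glued below a root. The class must vary because each edge
replaces it by an `improving` subset. -/
lemma shattersOn_iff_treeShatters {γ : ℝ} {n : ℕ} {V : Set (X → Z)} :
    P.ShattersOn V γ n ↔ P.TreeShatters γ n V := by
  induction n generalizing V with
  | zero =>
    constructor
    · rintro ⟨_, _, h⟩
      obtain ⟨h, hV, -⟩ := h Fin.elim0
      exact ⟨h, hV⟩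
    · rintro ⟨h, hV⟩
      exact ⟨fun t => t.elim0, fun t => t.elim0, fun _ => ⟨h, hV, fun t => t.elim0⟩⟩
  | succ n ih =>
    constructor
    · rintro ⟨tree, f, H⟩
      refine ⟨tree 0 Fin.elim0, fun μ => ⟨f 0 fun _ => μ, ih.1
        ⟨fun t ν => tree t.succ (Fin.cons μ ν), fun t ν => f t.succ (Fin.cons μ ν),
          fun ν => ?_⟩⟩⟩
      obtain ⟨h, hV, hh⟩ := H (Fin.cons μ ν)
      refine ⟨h, ⟨hV, ?_⟩, fun t => ?_⟩
      · have h0 := hh 0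
        have e1 : (fun i => (Fin.cons μ ν : Fin (n + 1) → ProbabilityMeasure Z)
            (Fin.castLE (0 : Fin (n + 1)).isLt i)) = fun _ => μ := by
          funext i
          have hi : i = (0 : Fin 1) := Subsingleton.elim (α := Fin 1) i 0
          rw [hi]; rfl
        have e2 : (fun i => (Fin.cons μ ν : Fin (n + 1) → ProbabilityMeasure Z)
            (Fin.castLE (0 : Fin (n + 1)).isLt.le i)) = Fin.elim0 := funext fun i => i.elim0
        rw [e1, e2] at h0
        exact h0
      · have ht := hh t.succ
        have e1 := congrArg (f t.succ) (cons_castLE t.isLt μ ν)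
        have e2 := congrArg (tree t.succ) (cons_castLE t.isLt.le μ ν)
        exact ((congrArg₂ (fun a b => P.loss a (h b) + γ) e1.symm e2.symm).le.trans ht).trans
          (congrArg (fun a => P.expLoss a (ν t)) e1).le
    · rintro ⟨x, H⟩
      choose y hy using H
      choose tree f hf using fun μ => ih.2 (hy μ)
      refine ⟨fun t => Fin.cases (motive := fun t => (Fin t.val → ProbabilityMeasure Z) → X)
          (fun _ => x) (fun t ν => tree (ν (0 : Fin (t.val + 1))) t fun i => ν i.succ) t,
        fun t => Fin.cases (motive := fun t => (Fin (t.val + 1) → ProbabilityMeasure Z) → Y)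
          (fun ν => y (ν 0)) (fun t ν => f (ν (0 : Fin (t.val + 2))) t fun i => ν i.succ) t, fun μ => ?_⟩
      obtain ⟨h, ⟨hV, h0⟩, hh⟩ := hf (μ 0) fun i => μ i.succ
      exact ⟨h, hV, fun t => Fin.cases h0 (fun t => hh t) t⟩

lemma shatters_iff_treeShatters {γ : ℝ} {n : ℕ} :
    P.Shatters γ n ↔ P.TreeShatters γ n P.H :=
  P.shattersOn_iff_treeShatters

lemma TreeShatters.nonempty {γ : ℝ} {n : ℕ} {V : Set (X → Z)} (hn : P.TreeShatters γ n V) :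
    V.Nonempty := by
  induction n generalizing V with
  | zero => exact hn
  | succ n ih =>
    obtain ⟨x, hx⟩ := hn
    -- Descending an edge needs some probability measure; the root x and any hypothesis provide a
    -- point of Z.
    by_cases hZ : Nonempty Z
    · obtain ⟨z⟩ := hZ
      obtain ⟨y, hy⟩ := hx (diracProba z)
      obtain ⟨h, hh⟩ := ih hy
      exact ⟨h, hh.1⟩
    · obtain ⟨h, -⟩ := P.H_nonempty
      exact absurd ⟨h x⟩ hZ

lemma TreeShatters.of_succ {γ : ℝ} {n : ℕ} {V : Set (X → Z)} (hn : P.TreeShatters γ (n + 1) V) :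
    P.TreeShatters γ n V := by
  induction n generalizing V with
  | zero => exact hn.nonempty
  | succ n ih =>
    obtain ⟨x, hx⟩ := hn
    exact ⟨x, fun μ => (hx μ).imp fun y hy => ih hy⟩

lemma TreeShatters.of_le {γ : ℝ} {m n : ℕ} {V : Set (X → Z)} (hmn : m ≤ n)
    (hn : P.TreeShatters γ n V) : P.TreeShatters γ m V := by
  induction hmn with
  | refl => exact hn
  | step _ ih => exact ih hn.of_succ

/-- Trees can be truncated, so the shattered depths form an initial segment and every natural number
below the supremum is attained. -/
lemma coe_le_SMdim_iff {γ : ℝ} {n : ℕ} :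
    (n : ℕ∞) ≤ P.SMdim γ ↔ P.TreeShatters γ n P.H := by
  constructor
  · intro hn
    cases n with
    | zero => exact P.H_nonempty
    | succ n =>
      by_contra hcon
      have : P.SMdim γ ≤ (n : ℕ∞) := iSup₂_le fun d hd => by
        rw [Nat.cast_le]
        by_contra hlt
        exact hcon (TreeShatters.of_le P (by omega) (P.shatters_iff_treeShatters.1 hd))
      have h2 := hn.trans this
      rw [Nat.cast_le] at h2
      omega
  · intro hn
    exact le_iSup₂_of_le n (P.shatters_iff_treeShatters.2 hn) le_rfl

/-! ### Expected losses -/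

lemma expLoss_nonneg (y : Y) (μ : ProbabilityMeasure Z) : 0 ≤ P.expLoss y μ :=
  integral_nonneg (P.loss_nonneg y)

lemma integrable_loss (y : Y) (μ : Measure Z) [IsFiniteMeasure μ] :
    Integrable (P.loss y) μ :=
  Integrable.of_bound (P.loss_measurable y).aestronglyMeasurable P.c
    (ae_of_all _ fun z => by
      rw [Real.norm_of_nonneg (P.loss_nonneg y z)]; exact P.loss_le y z)

lemma expLoss_le (y : Y) (μ : ProbabilityMeasure Z) : P.expLoss y μ ≤ P.c := by
  calc P.expLoss y μ ≤ ∫ _, P.c ∂(μ : Measure Z) :=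
        integral_mono (P.integrable_loss y _) (integrable_const _) (P.loss_le y)
    _ = P.c := by simp

lemma expLoss_dirac (y : Y) (z : Z) :
    P.expLoss y (diracProba z) = P.loss y z :=
  integral_dirac' _ _ (P.loss_measurable y).stronglyMeasurable

/-- The mixture of finitely many probability measures. -/
noncomputable def mixture {ι : Type*} [Fintype ι] (p : ι → ℝ) (hp : ∀ i, 0 ≤ p i)
    (hp1 : ∑ i, p i = 1) (μ : ι → ProbabilityMeasure Z) : ProbabilityMeasure Z :=
  ⟨∑ i, ENNReal.ofReal (p i) • (μ i : Measure Z), ⟨by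
    simp [← ENNReal.ofReal_sum_of_nonneg fun i _ => hp i, hp1]⟩⟩

lemma expLoss_mixture {ι : Type*} [Fintype ι] (p : ι → ℝ) (hp : ∀ i, 0 ≤ p i)
    (hp1 : ∑ i, p i = 1) (μ : ι → ProbabilityMeasure Z) (y : Y) :
    P.expLoss y (mixture p hp hp1 μ) = ∑ i, p i * P.expLoss y (μ i) := by
  have : P.expLoss y (mixture p hp hp1 μ)
      = ∫ z, P.loss y z ∂(∑ i, ENNReal.ofReal (p i) • (μ i : Measure Z)) := rfl
  rw [this, integral_finsetSum_measure]
  · refine Finset.sum_congr rfl fun i _ => ?_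
    rw [integral_smul_measure, ENNReal.toReal_ofReal (hp i)]
    rfl
  · intro i _
    exact (P.integrable_loss y _).smul_measure ENNReal.ofReal_ne_top

/-! ### Cumulative losses and regret -/

/-- The expected cumulative loss of a learner on a stream. -/
noncomputable def cumLoss (A : OnlineLearner X Y Z) {T : ℕ} (s : Fin T → X × Y) : ℝ :=
  ∑ t, P.expLoss (s t).2 (A (history s t) (s t).1)

/-- The cumulative loss of a hypothesis on a stream. -/
noncomputable def hypLoss (h : X → Z) {T : ℕ} (s : Fin T → X × Y) : ℝ :=
  ∑ t, P.loss (s t).2 (h (s t).1)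

lemma history_succ {T : ℕ} (s : Fin (T + 1) → X × Y) (t : Fin T) :
    history s t.succ = s 0 :: history (fun i => s i.succ) t := by
  simp only [history]
  exact List.ofFn_succ

/-- After one round a learner is again a learner, with the first example built in. The game
inductions on the horizon rest on this. -/
lemma cumLoss_succ (A : OnlineLearner X Y Z) {T : ℕ} (s : Fin (T + 1) → X × Y) :
    P.cumLoss A s = P.expLoss (s 0).2 (A [] (s 0).1)
      + P.cumLoss (fun l => A (s 0 :: l)) (fun t => s t.succ) := by
  simp only [cumLoss, Fin.sum_univ_succ, history_succ]
  rfl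

lemma hypLoss_succ (h : X → Z) {T : ℕ} (s : Fin (T + 1) → X × Y) :
    P.hypLoss h s = P.loss (s 0).2 (h (s 0).1) + P.hypLoss h (fun t => s t.succ) := by
  simp only [hypLoss, Fin.sum_univ_succ]

lemma cumLoss_zero (A : OnlineLearner X Y Z) (s : Fin 0 → X × Y) : P.cumLoss A s = 0 := by
  simp [cumLoss]

lemma hypLoss_zero (h : X → Z) (s : Fin 0 → X × Y) : P.hypLoss h s = 0 := by
  simp [hypLoss]

lemma hypLoss_nonneg (h : X → Z) {T : ℕ} (s : Fin T → X × Y) : 0 ≤ P.hypLoss h s :=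
  Finset.sum_nonneg fun _ _ => P.loss_nonneg _ _

lemma cumLoss_le (A : OnlineLearner X Y Z) {T : ℕ} (s : Fin T → X × Y) :
    P.cumLoss A s ≤ P.c * T := by
  calc P.cumLoss A s ≤ ∑ _t : Fin T, P.c := Finset.sum_le_sum fun _ _ => P.expLoss_le _ _
    _ = P.c * T := by simp [mul_comm]

lemma expRegret_le {A : OnlineLearner X Y Z} {T : ℕ} {s : Fin T → X × Y} {B : ℝ}
    (hB : ∀ h ∈ P.H, P.cumLoss A s ≤ P.hypLoss h s + B) : P.expRegret A s ≤ B := by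
  have : Nonempty P.H := P.H_nonempty.to_subtype
  have : P.cumLoss A s - B ≤ ⨅ h : P.H, P.hypLoss h.1 s :=
    le_ciInf fun h => by linarith [hB h.1 h.2]
  have e : P.expRegret A s = P.cumLoss A s - ⨅ h : P.H, P.hypLoss h.1 s := rfl
  linarith

lemma cumLoss_sub_hypLoss_le (A : OnlineLearner X Y Z) {T : ℕ} (s : Fin T → X × Y)
    {h : X → Z} (hh : h ∈ P.H) : P.cumLoss A s - P.hypLoss h s ≤ P.expRegret A s := by
  have : (⨅ h : P.H, P.hypLoss h.1 s) ≤ P.hypLoss h s :=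
    ciInf_le ⟨0, by rintro _ ⟨h, rfl⟩; exact P.hypLoss_nonneg _ _⟩ (⟨h, hh⟩ : P.H)
  have e : P.expRegret A s = P.cumLoss A s - ⨅ h : P.H, P.hypLoss h.1 s := rfl
  linarith

lemma expRegret_le_mul (A : OnlineLearner X Y Z) {T : ℕ} (s : Fin T → X × Y) :
    P.expRegret A s ≤ P.c * T :=
  P.expRegret_le fun h _ => by linarith [P.cumLoss_le A s, P.hypLoss_nonneg h s]

lemma nonempty_onlineLearner (P : LearningProblem X Y Z) : Nonempty (OnlineLearner X Y Z) := by
  obtain ⟨h, -⟩ := P.H_nonempty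
  exact ⟨fun _ x => (diracProba (h x))⟩

/-! ### The lower bound for every learner -/

/-- The adversary queries the root, reads off the learner's measure, and answers with the label on
that edge; all hypotheses that survive have gained γ. -/
lemma TreeShatters.exists_stream {γ : ℝ} {n : ℕ} {V : Set (X → Z)}
    (hn : P.TreeShatters γ n V) (A : OnlineLearner X Y Z) :
    ∃ s : Fin n → X × Y, ∃ h ∈ V, P.hypLoss h s + γ * n ≤ P.cumLoss A s := by
  induction n generalizing V A with
  | zero =>
    obtain ⟨h, hV⟩ := hn
    exact ⟨Fin.elim0, h, hV, by simp [hypLoss, cumLoss]⟩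
  | succ n ih =>
    obtain ⟨x, hx⟩ := hn
    obtain ⟨y, hy⟩ := hx (A [] x)
    obtain ⟨s, h, ⟨hV, h0⟩, hs⟩ := ih hy fun l => A ((x, y) :: l)
    refine ⟨Fin.cons (x, y) s, h, hV, ?_⟩
    rw [P.cumLoss_succ, P.hypLoss_succ]
    simp only [Fin.cons_zero, Fin.cons_succ]
    push_cast
    linarith

lemma exists_stream_of_le_SMdim {γ : ℝ} {n : ℕ} (hn : (n : ℕ∞) ≤ P.SMdim γ)
    (A : OnlineLearner X Y Z) : ∃ s : Fin n → X × Y, γ * n ≤ P.expRegret A s := by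
  obtain ⟨s, h, hH, hs⟩ := TreeShatters.exists_stream P (P.coe_le_SMdim_iff.1 hn) A
  exact ⟨s, by linarith [P.cumLoss_sub_hypLoss_le A s hH]⟩

lemma exists_stream_of_lt_lowerBound (hP : 0 < ⨆ (γ : ℝ) (_ : 0 < γ), P.SMdim γ)
    (A : OnlineLearner X Y Z) (r : ℝ) (hr : (r : EReal) < (P.lowerBound : EReal)) :
    ∃ T : ℕ, 0 < T ∧ ∃ s : Fin T → X × Y, r < P.expRegret A s := by
  -- For negative r the empty stream would do but is not allowed; a tree of depth 1 supplies a
  -- nonempty one.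
  rcases lt_or_ge r 0 with h0 | h0
  · simp only [lt_iSup_iff] at hP
    obtain ⟨γ, hγ, h⟩ := hP
    obtain ⟨s, hs⟩ := P.exists_stream_of_le_SMdim (n := 1)
      (by simpa using Order.one_le_iff_pos.2 h) A
    exact ⟨1, one_pos, s, by push_cast at hs; linarith⟩
  · have hr' : ENNReal.ofReal r < P.lowerBound := by
      rw [← EReal.coe_ennreal_lt_coe_ennreal_iff, EReal.coe_ennreal_ofReal, max_eq_left h0]
      exact hr
    simp only [lowerBound, lt_iSup_iff] at hr'
    obtain ⟨γ, hγ, h⟩ := hr'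
    obtain ⟨n, hn, hrn⟩ : ∃ n : ℕ, (n : ℕ∞) ≤ P.SMdim γ ∧ r < γ * n := by
      rcases eq_or_ne (P.SMdim γ) ⊤ with ht | ht
      · obtain ⟨n, hn⟩ := exists_nat_gt (r / γ)
        exact ⟨n, by simp [ht], by rwa [div_lt_iff₀' hγ] at hn⟩
      · obtain ⟨n, hn⟩ := ENat.ne_top_iff_exists.1 ht
        refine ⟨n, hn.le, ?_⟩
        rw [← hn] at h
        have : ENNReal.ofReal r < ENNReal.ofReal (γ * n) := by
          rw [ENNReal.ofReal_mul hγ.le, ENNReal.ofReal_natCast]; simpa using h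
        exact (ENNReal.ofReal_lt_ofReal_iff_of_nonneg h0).1 this
    obtain ⟨s, hs⟩ := P.exists_stream_of_le_SMdim hn A
    refine ⟨n, Nat.pos_of_ne_zero ?_, s, by linarith⟩
    rintro rfl
    simp at hrn
    linarith

/-! ### Exponential weights -/

/-- Hoeffding's lemma for the finite distribution p, with the moment generating function evaluated
at -η. -/
lemma sum_mul_exp_neg_le {ι : Type*} [Fintype ι] (p x : ι → ℝ) (hp : ∀ i, 0 ≤ p i)
    (hp1 : ∑ i, p i = 1) {c : ℝ} (hx : ∀ i, x i ∈ Set.Icc 0 c) (η : ℝ) :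
    ∑ i, p i * Real.exp (-(η * x i))
      ≤ Real.exp (-(η * ∑ i, p i * x i) + η ^ 2 * c ^ 2 / 8) := by
  let _ : MeasurableSpace ι := ⊤
  let ν : Measure ι := ∑ i, ENNReal.ofReal (p i) • Measure.dirac i
  have : IsProbabilityMeasure ν := ⟨by
    simp [ν, ← ENNReal.ofReal_sum_of_nonneg fun i _ => hp i, hp1]⟩
  have hint : ∀ f : ι → ℝ, ∫ i, f i ∂ν = ∑ i, p i * f i := by
    intro f
    simp only [ν]
    rw [integral_finsetSum_measure]
    · refine Finset.sum_congr rfl fun i _ => ?_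
      rw [integral_smul_measure, ENNReal.toReal_ofReal (hp i), integral_dirac, smul_eq_mul]
    · intro i _
      exact (integrable_dirac (by simp)).smul_measure ENNReal.ofReal_ne_top
  have hH := (ProbabilityTheory.hasSubgaussianMGF_of_mem_Icc (μ := ν) (X := x) (a := 0) (b := c)
    (measurable_of_finite x).aemeasurable (ae_of_all _ hx)).mgf_le (-η)
  rw [ProbabilityTheory.mgf, hint, hint] at hH
  have hc : (((‖c - 0‖₊ / 2) ^ 2 : NNReal) : ℝ) * (-η) ^ 2 / 2 = η ^ 2 * c ^ 2 / 8 := by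
    push_cast
    rw [sub_zero, Real.norm_eq_abs, div_pow, sq_abs]
    ring
  rw [hc] at hH
  rw [Real.exp_add]
  calc ∑ i, p i * Real.exp (-(η * x i))
      = Real.exp (-(η * ∑ i, p i * x i))
          * ∑ i, p i * Real.exp (-η * (x i - ∑ i, p i * x i)) := by
        rw [Finset.mul_sum]
        refine Finset.sum_congr rfl fun i _ => ?_
        rw [mul_left_comm, ← Real.exp_add]
        congr 2
        ring
    _ ≤ _ := mul_le_mul_of_nonneg_left hH (Real.exp_pos _).le

/-- The first prediction is the weighted mixture of the experts' measures, whose expected loss is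
the weighted average, so no convexity of the loss is needed. Arbitrary weights let the induction
absorb the first round's exponential factors. -/
lemma exists_expWeights_learner {ι : Type*} [Fintype ι] [Nonempty ι] (T : ℕ) (η : ℝ)
    (w : ι → ℝ) (hw : ∀ i, 0 < w i) (E : ι → OnlineLearner X Y Z) :
    ∃ A : OnlineLearner X Y Z, ∀ s : Fin T → X × Y,
      ∑ i, w i * Real.exp (-(η * P.cumLoss (E i) s))
        ≤ (∑ i, w i) * Real.exp (-(η * P.cumLoss A s) + T * (η ^ 2 * P.c ^ 2 / 8)) := by
  induction T generalizing w E with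
  | zero =>
    obtain ⟨A⟩ := P.nonempty_onlineLearner
    exact ⟨A, fun s => by simp [cumLoss_zero]⟩
  | succ T ih =>
    set W := ∑ i, w i with hWdef
    have hW : 0 < W := Finset.sum_pos (fun i _ => hw i) Finset.univ_nonempty
    have hp : ∀ i, 0 ≤ w i / W := fun i => (div_pos (hw i) hW).le
    have hp1 : ∑ i, w i / W = 1 := by rw [← Finset.sum_div, div_self hW.ne']
    choose B hB using fun a : X × Y =>
      ih (fun i => w i * Real.exp (-(η * P.expLoss a.2 (E i [] a.1))))
        (fun i => mul_pos (hw i) (Real.exp_pos _)) (fun i l => E i (a :: l))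
    let μ : X → ProbabilityMeasure Z := fun x => mixture _ hp hp1 fun i => E i [] x
    let A : OnlineLearner X Y Z := fun l => l.rec μ fun a l _ => B a l
    refine ⟨A, fun s => ?_⟩
    have h1 := hB (s 0) fun t => s t.succ
    have h2 := sum_mul_exp_neg_le (fun i => w i / W) (fun i => P.expLoss (s 0).2 (E i [] (s 0).1))
      hp hp1 (fun i => ⟨P.expLoss_nonneg _ _, P.expLoss_le _ _⟩) η
    rw [← P.expLoss_mixture _ hp hp1 fun i => E i [] (s 0).1] at h2
    have h3 : ∑ i, w i * Real.exp (-(η * P.expLoss (s 0).2 (E i [] (s 0).1)))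
        ≤ W * Real.exp (-(η * P.expLoss (s 0).2 (μ (s 0).1)) + η ^ 2 * P.c ^ 2 / 8) := by
      refine le_trans (le_of_eq ?_) (mul_le_mul_of_nonneg_left h2 hW.le)
      rw [Finset.mul_sum]
      refine Finset.sum_congr rfl fun i _ => ?_
      field_simp
    have e : P.cumLoss A s = P.expLoss (s 0).2 (μ (s 0).1)
        + P.cumLoss (B (s 0)) (fun t => s t.succ) := P.cumLoss_succ A s
    calc ∑ i, w i * Real.exp (-(η * P.cumLoss (E i) s))
        = ∑ i, w i * Real.exp (-(η * P.expLoss (s 0).2 (E i [] (s 0).1)))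
            * Real.exp (-(η * P.cumLoss (fun l => E i (s 0 :: l)) fun t => s t.succ)) := by
          refine Finset.sum_congr rfl fun i _ => ?_
          rw [P.cumLoss_succ, mul_assoc, ← Real.exp_add]
          congr 2
          ring
      _ ≤ _ := h1
      _ ≤ _ := mul_le_mul_of_nonneg_right h3 (Real.exp_pos _).le
      _ = _ := by
          rw [mul_assoc, ← Real.exp_add, e]
          congr 2
          push_cast
          ring

/-! ### Experts from the minimax algorithm -/

/-- The number of rounds that a selector `b` marks. -/
def numMarked {T : ℕ} (b : Fin T → Bool) : ℕ := ∑ t, (b t).toNat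

lemma numMarked_cons {T : ℕ} (a : Bool) (b : Fin T → Bool) :
    numMarked (Fin.cons a b : Fin (T + 1) → Bool) = a.toNat + numMarked b := by
  simp [numMarked, Fin.sum_univ_succ]

/-- The expert `b` plays the minimax measure and shrinks its version space exactly in the rounds
that `b` marks. For given h the right `b` marks the rounds in which h beats that measure by γ. Each
mark lowers n by one, and n cannot reach 0 while h survives. -/
lemma exists_experts {γ : ℝ} (hγ : 0 ≤ γ) (T n : ℕ) (V : Set (X → Z))
    (hV : ¬ P.TreeShatters γ n V) :
    ∃ E : (Fin T → Bool) → OnlineLearner X Y Z, ∀ s : Fin T → X × Y, ∀ h ∈ V,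
      ∃ b : Fin T → Bool, numMarked b + 1 ≤ n ∧
        P.cumLoss (E b) s ≤ P.hypLoss h s + γ * T + P.c * numMarked b := by
  obtain ⟨A₀⟩ := P.nonempty_onlineLearner
  induction T generalizing n V with
  | zero =>
    refine ⟨fun _ => A₀, fun s h hh => ⟨Fin.elim0, ?_, ?_⟩⟩
    · cases n with
      | zero => exact absurd ⟨h, hh⟩ hV
      | succ n => simp [numMarked]
    · simp [cumLoss_zero, hypLoss_zero, numMarked]
  | succ T ih =>
    cases n with
    | zero => exact ⟨fun _ => A₀, fun s h hh => absurd ⟨h, hh⟩ hV⟩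
    | succ n =>
      have hμ : ∀ x, ∃ μ, ∀ y, ¬ P.TreeShatters γ n (P.improving γ V x y μ) := by
        intro x
        by_contra! hcon
        exact hV ⟨x, hcon⟩
      choose μ hμ using hμ
      obtain ⟨E₀, hE₀⟩ := ih (n + 1) V hV
      choose E₁ hE₁ using fun a : X × Y => ih n _ (hμ a.1 a.2)
      -- The mark of a round takes effect only once its label is known, so the first prediction does
      -- not depend on `b`.
      let E : (Fin (T + 1) → Bool) → OnlineLearner X Y Z := fun b l =>
        l.rec μ fun a l _ => if b 0 then E₁ a (fun t => b t.succ) l else E₀ (fun t => b t.succ) l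
      refine ⟨E, fun s h hh => ?_⟩
      by_cases h0 : h ∈ P.improving γ V (s 0).1 (s 0).2 (μ (s 0).1)
      · obtain ⟨b, hbn, hb⟩ := hE₁ (s 0) (fun t => s t.succ) h h0
        have e : P.cumLoss (E (Fin.cons true b)) s = P.expLoss (s 0).2 (μ (s 0).1)
            + P.cumLoss (E₁ (s 0) b) (fun t => s t.succ) := P.cumLoss_succ _ s
        refine ⟨Fin.cons true b, ?_, ?_⟩
        · rw [numMarked_cons, Bool.toNat_true]; omega
        · rw [e, P.hypLoss_succ, numMarked_cons, Bool.toNat_true]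
          push_cast
          linarith [P.expLoss_le (s 0).2 (μ (s 0).1), P.loss_nonneg (s 0).2 (h (s 0).1)]
      · obtain ⟨b, hbn, hb⟩ := hE₀ (fun t => s t.succ) h hh
        have e : P.cumLoss (E (Fin.cons false b)) s = P.expLoss (s 0).2 (μ (s 0).1)
            + P.cumLoss (E₀ b) (fun t => s t.succ) := P.cumLoss_succ _ s
        have h1 : P.expLoss (s 0).2 (μ (s 0).1) < P.loss (s 0).2 (h (s 0).1) + γ := by
          by_contra! hcon
          exact h0 ⟨hh, hcon⟩
        refine ⟨Fin.cons false b, ?_, ?_⟩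
        · rw [numMarked_cons, Bool.toNat_false]; omega
        · rw [e, P.hypLoss_succ, numMarked_cons, Bool.toNat_false]
          push_cast
          linarith

/-- Total mass of the product prior: weighting all selectors this way avoids counting those with few
marks. -/
lemma sum_pow_numMarked (q : ℝ) (T : ℕ) :
    ∑ b : Fin T → Bool, q ^ numMarked b = (1 + q) ^ T := by
  have h : ∀ b : Fin T → Bool, q ^ numMarked b = ∏ t, q ^ (b t).toNat := fun b => by
    rw [numMarked, Finset.prod_pow_eq_pow_sum]
  simp_rw [h]
  have h2 := Finset.prod_univ_sum (fun _ : Fin T => (Finset.univ : Finset Bool))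
    fun _ a => q ^ a.toNat
  rw [Fintype.piFinset_univ] at h2
  rw [← h2]
  simp [add_comm]

/-! ### The upper bound -/

/-- With a = c²Td the squared left side is a/2 + a ln(cT) - (a ln a)/2. Since -a ln a ≤ 1 - a, it is
at most 1/2 + a ln(2cT), and 1/2 is below (3/4)². -/
lemma mul_sqrt_le {c d T : ℝ} (hc : 0 < c) (hd : 0 < d) (hdT : d ≤ T) (hcT : 1 ≤ c * T) :
    c * √(T * (d - d * Real.log (d / T)) / 2)
      ≤ 3 / 4 + 2 * c * √(d * T * Real.log (2 * c * T)) := by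
  have hT : 0 < T := hd.trans_le hdT
  have hlog : 0 ≤ d - d * Real.log (d / T) := by
    have := Real.log_nonpos (by positivity) ((div_le_one hT).2 hdT)
    nlinarith
  set a := c ^ 2 * T * d with ha
  have ha0 : 0 < a := by positivity
  have hlogK : 0 ≤ Real.log (c * T) := Real.log_nonneg hcT
  have hlog2 : Real.log (c * T) ≤ Real.log (2 * c * T) :=
    Real.log_le_log (by linarith) (by nlinarith)
  have e1 : d / T = a / (c * T) ^ 2 := by rw [ha]; field_simp
  have e2 : Real.log (d / T) = Real.log a - 2 * Real.log (c * T) := by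
    rw [e1, Real.log_div ha0.ne' (by positivity), Real.log_pow]; norm_num
  have h1 : -(a * Real.log a) ≤ 1 - a := by
    have := Real.log_le_sub_one_of_pos (inv_pos.2 ha0)
    rw [Real.log_inv] at this
    have := mul_le_mul_of_nonneg_left this ha0.le
    rw [mul_sub, mul_inv_cancel₀ ha0.ne'] at this
    linarith
  have hQ := Real.sq_sqrt (show 0 ≤ d * T * Real.log (2 * c * T) by
    have : 0 ≤ Real.log (2 * c * T) := by linarith
    positivity)
  have hQ0 := Real.sqrt_nonneg (d * T * Real.log (2 * c * T))
  set Q := √(d * T * Real.log (2 * c * T))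
  refine le_of_sq_le_sq ?_ (by positivity)
  have hX : c ^ 2 * (T * (d - d * Real.log (d / T)) / 2)
      = a / 2 + a * Real.log (c * T) - a * Real.log a / 2 := by
    rw [e2, ha]; ring
  rw [mul_pow, Real.sq_sqrt (by positivity), hX]
  have h4 : a * Real.log (c * T) ≤ a * Real.log (2 * c * T) :=
    mul_le_mul_of_nonneg_left hlog2 ha0.le
  have h5 : 0 ≤ a * Real.log (c * T) := by positivity
  have h6 : (2 * c * Q) ^ 2 = 4 * (a * Real.log (2 * c * T)) := by
    rw [mul_pow, hQ, ha]; ring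
  have h7 : 0 ≤ 2 * c * Q := by positivity
  nlinarith

lemma exists_learner_of_not_treeShatters {γ : ℝ} (hγ : 0 ≤ γ) {T d : ℕ} (hT : 0 < T)
    (hcT : 1 ≤ P.c * T) (hd : ¬ P.TreeShatters γ (d + 1) P.H) :
    ∃ A : OnlineLearner X Y Z, ∀ s : Fin T → X × Y, P.expRegret A s
      ≤ P.c * d + γ * T + 3 / 4 + 2 * P.c * √(d * T * Real.log (2 * P.c * T)) := by
  have hc := P.c_pos
  have hT' : (0 : ℝ) < T := Nat.cast_pos.2 hT
  obtain ⟨E, hE⟩ := P.exists_experts hγ T (d + 1) P.H hd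
  rcases Nat.eq_zero_or_pos d with rfl | hd0
  · refine ⟨E fun _ => false, fun s => P.expRegret_le fun h hh => ?_⟩
    obtain ⟨b, hb, hs⟩ := hE s h hh
    have hb0 : numMarked b = 0 := by omega
    have : b = fun _ => false := by
      funext t
      simpa using (Finset.sum_eq_zero_iff.1 hb0) t (Finset.mem_univ t)
    rw [hb0, this] at hs
    simp only [Nat.cast_zero, mul_zero, zero_mul, Real.sqrt_zero] at hs ⊢
    linarith
  rcases le_total T d with hTd | hdT
  · obtain ⟨A⟩ := P.nonempty_onlineLearner
    refine ⟨A, fun s => (P.expRegret_le_mul A s).trans ?_⟩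
    have h1 : P.c * T ≤ P.c * d := mul_le_mul_of_nonneg_left (Nat.cast_le.2 hTd) hc.le
    have h2 : 0 ≤ γ * T := by positivity
    have h3 : 0 ≤ 2 * P.c * √(d * T * Real.log (2 * P.c * T)) := by positivity
    linarith
  · have hd' : (0 : ℝ) < d := Nat.cast_pos.2 hd0
    -- This q keeps the total prior mass (1 + q)^T below e^d, while an expert with at most d marks
    -- has weight at least q^d. The logarithm of the ratio of these bounds is `M`.
    set q : ℝ := d / T with hq
    have hq0 : 0 < q := by positivity
    have hq1 : q ≤ 1 := (div_le_one hT').2 (Nat.cast_le.2 hdT)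
    have hlogq : Real.log q ≤ 0 := Real.log_nonpos hq0.le hq1
    set M : ℝ := d - d * Real.log q with hM
    have hM0 : 0 < M := by nlinarith
    set r : ℝ := √(T * M / 2) with hr
    have hr0 : 0 < r := Real.sqrt_pos.2 (by positivity)
    have hr2 : r ^ 2 = T * M / 2 := Real.sq_sqrt (by positivity)
    -- The minimizer of M/η + Tηc²/8; the minimum is c * r.
    set η : ℝ := 4 * r / (T * P.c) with hη
    have hη0 : 0 < η := by positivity
    obtain ⟨A, hA⟩ := P.exists_expWeights_learner T η (fun b => q ^ numMarked b)
      (fun b => by positivity) E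
    refine ⟨A, fun s => P.expRegret_le fun h hh => ?_⟩
    obtain ⟨b, hb, hs⟩ := hE s h hh
    have h1 : q ^ d * Real.exp (-(η * P.cumLoss (E b) s))
        ≤ Real.exp d * Real.exp (-(η * P.cumLoss A s) + T * (η ^ 2 * P.c ^ 2 / 8)) := by
      refine le_trans ?_ ((hA s).trans ?_)
      · refine le_trans ?_ (Finset.single_le_sum (f := fun b =>
          q ^ numMarked b * Real.exp (-(η * P.cumLoss (E b) s)))
          (fun i _ => by positivity) (Finset.mem_univ b))
        exact mul_le_mul_of_nonneg_right (pow_le_pow_of_le_one hq0.le hq1 (by omega))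
          (Real.exp_pos _).le
      · rw [sum_pow_numMarked]
        refine mul_le_mul_of_nonneg_right ?_ (Real.exp_pos _).le
        calc (1 + q) ^ T ≤ (Real.exp q) ^ T :=
              pow_le_pow_left₀ (by positivity) (by linarith [Real.add_one_le_exp q]) _
          _ = Real.exp d := by rw [← Real.exp_nat_mul, hq]; congr 1; field_simp
    have h2 := Real.log_le_log (by positivity) h1
    rw [Real.log_mul (by positivity) (by positivity), Real.log_mul (by positivity) (by positivity),
      Real.log_exp, Real.log_exp, Real.log_exp, Real.log_pow] at h2
    have h3 : P.cumLoss A s ≤ P.cumLoss (E b) s + P.c * r := by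
      have h4 : η * (P.c * r) = M + T * (η ^ 2 * P.c ^ 2 / 8) := by
        have : M = 2 * r ^ 2 / T := by rw [hr2]; field_simp
        rw [this, hη]; field_simp; ring
      have h5 : η * P.cumLoss A s ≤ η * (P.cumLoss (E b) s + P.c * r) := by
        rw [mul_add, h4, hM]; linarith
      exact le_of_mul_le_mul_left h5 hη0
    have h4 : P.c * numMarked b ≤ P.c * d :=
      mul_le_mul_of_nonneg_left (Nat.cast_le.2 (by omega)) hc.le
    have h5 := mul_sqrt_le hc hd' (Nat.cast_le.2 hdT) hcT
    linarith

lemma not_treeShatters_of_SMdim_eq {γ : ℝ} {d : ℕ} (h : P.SMdim γ = d) :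
    ¬ P.TreeShatters γ (d + 1) P.H := by
  rw [← P.coe_le_SMdim_iff, h, Nat.cast_le]
  omega

theorem exists_learner_le_upperBound {T : ℕ} (hT : 0 < T) :
    ∃ A : OnlineLearner X Y Z, ∀ s : Fin T → X × Y,
      ((P.expRegret A s : ℝ) : EReal) ≤ P.upperBound T := by
  have hc := P.c_pos
  -- If cT ≤ 1, the trivial bound cT is already covered by the summand 1.
  rcases le_total (P.c * T) 1 with hcT | hcT
  · obtain ⟨A⟩ := P.nonempty_onlineLearner
    refine ⟨A, fun s => le_iInf₂ fun γ hγ => le_iInf₂ fun d _ => EReal.coe_le_coe_iff.2 ?_⟩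
    have h1 := P.expRegret_le_mul A s
    have h2 : 0 ≤ P.c * d + γ * T + 2 * P.c * √(d * T * Real.log (2 * P.c * T)) := by positivity
    linarith
  · obtain ⟨A₀⟩ := P.nonempty_onlineLearner
    rcases eq_or_ne (P.upperBound T) ⊤ with htop | htop
    · exact ⟨A₀, fun s => htop ▸ le_top⟩
    have hbot : (0 : EReal) ≤ P.upperBound T :=
      le_iInf₂ fun γ hγ => le_iInf₂ fun d _ => EReal.coe_nonneg.2 (by positivity)
    lift P.upperBound T to ℝ using ⟨htop, ne_bot_of_le_ne_bot (by simp) hbot⟩ with u hu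
    -- The infimum over γ need not be attained; the gap between 3/4 and 1 pays for a near-minimizer.
    have hlt : P.upperBound T < ((u + 1 / 4 : ℝ) : EReal) := by
      rw [← hu, EReal.coe_lt_coe_iff]; linarith
    simp only [upperBound, iInf_lt_iff, EReal.coe_lt_coe_iff] at hlt
    obtain ⟨γ, hγ, d, hd, hlt⟩ := hlt
    obtain ⟨A, hA⟩ := P.exists_learner_of_not_treeShatters hγ.le hT hcT
      (P.not_treeShatters_of_SMdim_eq hd)
    exact ⟨A, fun s => EReal.coe_le_coe_iff.2 (by linarith [hA s])⟩

/-! ### The characterization of learnability -/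

/-- Half of the slope ε is spent on the scale γ = ε/2, the other half on the square root, which
grows slower than any linear function. -/
lemma exists_upperBound_le (hP : ∀ γ : ℝ, 0 < γ → P.SMdim γ ≠ ⊤) {ε : ℝ} (hε : 0 < ε) :
    ∃ C : ℝ, 0 ≤ C ∧ ∀ n : ℕ, 0 < n → P.upperBound n ≤ ((ε * n + C : ℝ) : EReal) := by
  have hc := P.c_pos
  obtain ⟨d, hd⟩ := ENat.ne_top_iff_exists.1 (hP (ε / 2) (by positivity))
  set δ : ℝ := ε / (4 * P.c) with hδ
  have hδ0 : 0 < δ := by positivity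
  -- κ and `C'` are chosen to fit d n ln(2cn) under (δn + C')²: dκ ≤ δ² handles the quadratic term,
  -- and 2δnC' the linear one.
  set κ : ℝ := δ ^ 2 / (d + 1) with hκ
  have hκ0 : 0 < κ := by positivity
  set C' : ℝ := d * |Real.log (2 * P.c / κ)| / (2 * δ) with hC'
  have hC'0 : 0 ≤ C' := by positivity
  refine ⟨P.c * d + 1 + 2 * P.c * C', by positivity, fun n hn => ?_⟩
  have hn' : (0 : ℝ) < n := Nat.cast_pos.2 hn
  refine (iInf₂_le_of_le (ε / 2) (by positivity) (iInf₂_le_of_le d hd.symm le_rfl)).trans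
    (EReal.coe_le_coe_iff.2 ?_)
  have hL : Real.log (2 * P.c * n) ≤ κ * n + |Real.log (2 * P.c / κ)| := by
    have e : 2 * P.c * n = (κ * n) * (2 * P.c / κ) := by field_simp
    rw [e, Real.log_mul (by positivity) (by positivity)]
    linarith [Real.log_le_sub_one_of_pos (mul_pos hκ0 hn'), le_abs_self (Real.log (2 * P.c / κ))]
  have hdκ : d * κ ≤ δ ^ 2 := by
    rw [hκ, mul_div_assoc', div_le_iff₀ (by positivity)]
    nlinarith [sq_nonneg δ]
  have hs : √(d * n * Real.log (2 * P.c * n)) ≤ δ * n + C' := by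
    refine Real.sqrt_le_iff.2 ⟨by positivity, ?_⟩
    have h1 : d * n * Real.log (2 * P.c * n) ≤ d * n * (κ * n + |Real.log (2 * P.c / κ)|) :=
      mul_le_mul_of_nonneg_left hL (by positivity)
    have h2 : d * n * (κ * n) ≤ δ ^ 2 * n ^ 2 := by
      nlinarith [mul_le_mul_of_nonneg_right hdκ (sq_nonneg (n : ℝ))]
    have h3 : d * n * |Real.log (2 * P.c / κ)| = 2 * (δ * n) * C' := by
      rw [hC']; field_simp
    nlinarith [sq_nonneg C']
  have h4 : 2 * P.c * (δ * n + C') = ε / 2 * n + 2 * P.c * C' := by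
    rw [hδ]; field_simp; ring
  have h5 := mul_le_mul_of_nonneg_left hs (by positivity : 0 ≤ 2 * P.c)
  linarith

/-- The learner that restarts at every perfect square, using `B k` from round `k ^ 2` on. -/
def restart (B : ℕ → OnlineLearner X Y Z) : OnlineLearner X Y Z :=
  fun l => B l.length.sqrt (l.drop (l.length.sqrt ^ 2))

lemma cumLoss_eq_sum_range (A : OnlineLearner X Y Z) (s : ℕ → X × Y) (T : ℕ) :
    P.cumLoss A (fun t : Fin T => s t)
      = ∑ t ∈ Finset.range T, P.expLoss (s t).2 (A ((List.range t).map s) (s t).1) := by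
  rw [Finset.sum_range, cumLoss]
  refine Finset.sum_congr rfl fun t _ => ?_
  have : history (fun t : Fin T => s t) t = (List.range t).map s := by
    apply List.ext_getElem <;> simp [history]
  rw [this]

lemma hypLoss_eq_sum_range (h : X → Z) (s : ℕ → X × Y) (T : ℕ) :
    P.hypLoss h (fun t : Fin T => s t)
      = ∑ t ∈ Finset.range T, P.loss (s t).2 (h (s t).1) := by
  rw [Finset.sum_range, hypLoss]

/-- Regret bounds add over blocks because the same h is a competitor on each. Block k has the 2k + 1
rounds whose index has integer square root k. -/
lemma cumLoss_restart_le (B : ℕ → OnlineLearner X Y Z) (r : ℕ → ℝ)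
    (hB : ∀ (k : ℕ) (s : Fin (2 * k + 1) → X × Y), P.expRegret (B k) s ≤ r k)
    (s : ℕ → X × Y) {h : X → Z} (hh : h ∈ P.H) (k : ℕ) :
    P.cumLoss (restart B) (fun t : Fin (k ^ 2) => s t)
      ≤ P.hypLoss h (fun t : Fin (k ^ 2) => s t) + ∑ j ∈ Finset.range k, r j := by
  simp only [cumLoss_eq_sum_range, hypLoss_eq_sum_range]
  induction k with
  | zero => simp
  | succ k ih =>
    rw [show (k + 1) ^ 2 = k ^ 2 + (2 * k + 1) by ring, Finset.sum_range_add _ (k ^ 2) (2 * k + 1),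
      Finset.sum_range_add _ (k ^ 2) (2 * k + 1), Finset.sum_range_succ r]
    have h1 := (P.cumLoss_sub_hypLoss_le (B k) (fun t : Fin (2 * k + 1) => s (k ^ 2 + t)) hh).trans
      (hB k _)
    rw [P.cumLoss_eq_sum_range (B k) (fun t => s (k ^ 2 + t)),
      P.hypLoss_eq_sum_range h (fun t => s (k ^ 2 + t))] at h1
    have h2 : ∀ i ∈ Finset.range (2 * k + 1),
        P.expLoss (s (k ^ 2 + i)).2
          (restart B ((List.range (k ^ 2 + i)).map s) (s (k ^ 2 + i)).1)
        = P.expLoss (s (k ^ 2 + i)).2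
          (B k ((List.range i).map fun t => s (k ^ 2 + t)) (s (k ^ 2 + i)).1) := by
      intro i hi
      have hk : (k ^ 2 + i).sqrt = k := Nat.sqrt_add_eq' k (by
        have := Finset.mem_range.1 hi; omega)
      have hl : ((List.range (k ^ 2 + i)).map s).drop (k ^ 2)
          = (List.range i).map fun t => s (k ^ 2 + t) := by
        apply List.ext_getElem <;> simp
      simp only [restart, List.length_map, List.length_range, hk, hl]
    rw [Finset.sum_congr rfl h2]
    linarith

lemma expRegret_restart_le (B : ℕ → OnlineLearner X Y Z) (r : ℕ → ℝ)
    (hB : ∀ (k : ℕ) (s : Fin (2 * k + 1) → X × Y), P.expRegret (B k) s ≤ r k)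
    (T : ℕ) (s : Fin T → X × Y) :
    P.expRegret (restart B) s ≤ ∑ j ∈ Finset.range T.sqrt, r j + 2 * P.c * T.sqrt := by
  have hc := P.c_pos
  refine P.expRegret_le fun h hh => ?_
  rcases Nat.eq_zero_or_pos T with rfl | hT
  · simp [cumLoss_zero, hypLoss_zero]
  -- The values from T on are never read; the extension only permits sums over ranges.
  let s' : ℕ → X × Y := fun n => if hn : n < T then s ⟨n, hn⟩ else s ⟨0, hT⟩
  have hs : s = fun t : Fin T => s' t := by funext t; simp [s']
  obtain ⟨m, hm⟩ := Nat.exists_eq_add_of_le (Nat.sqrt_le' T)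
  have hm2 : m ≤ 2 * T.sqrt := by
    have := Nat.lt_succ_sqrt' T
    rw [Nat.succ_eq_add_one, show (T.sqrt + 1) ^ 2 = T.sqrt ^ 2 + (2 * T.sqrt + 1) by ring] at this
    omega
  have h1 := P.cumLoss_restart_le B r hB s' hh T.sqrt
  rw [hs]
  simp only [cumLoss_eq_sum_range, hypLoss_eq_sum_range] at h1 ⊢
  generalize T.sqrt = k at hm hm2 h1 ⊢
  rw [hm, Finset.sum_range_add, Finset.sum_range_add]
  have h2 : ∑ i ∈ Finset.range m, P.expLoss (s' (k ^ 2 + i)).2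
      (restart B ((List.range (k ^ 2 + i)).map s') (s' (k ^ 2 + i)).1) ≤ m * P.c := by
    calc _ ≤ ∑ _i ∈ Finset.range m, P.c := Finset.sum_le_sum fun _ _ => P.expLoss_le _ _
      _ = m * P.c := by simp
  have h3 : 0 ≤ ∑ i ∈ Finset.range m, P.loss (s' (k ^ 2 + i)).2 (h (s' (k ^ 2 + i)).1) :=
    Finset.sum_nonneg fun _ _ => P.loss_nonneg _ _
  have h4 : (m : ℝ) * P.c ≤ 2 * k * P.c :=
    mul_le_mul_of_nonneg_right (by exact_mod_cast hm2) hc.le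
  linarith

/-- The block lengths 2k + 1 sum to K² ≤ T, so slope ε/2 survives the summation, and the remaining
terms are linear in K = √T. -/
lemma tendsto_sum_sqrt_div {r : ℕ → ℝ} (hr : ∀ k, 0 ≤ r k) {c : ℝ} (hc : 0 ≤ c)
    (hlin : ∀ ε : ℝ, 0 < ε → ∃ C : ℝ, 0 ≤ C ∧ ∀ k : ℕ, r k ≤ ε * (2 * k + 1) + C) :
    Tendsto (fun T : ℕ => (∑ j ∈ Finset.range T.sqrt, r j + 2 * c * T.sqrt) / T) atTop (𝓝 0) := by
  rw [Metric.tendsto_atTop]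
  intro ε hε
  obtain ⟨C, hC, hCr⟩ := hlin (ε / 2) (by positivity)
  obtain ⟨N, hN⟩ := exists_nat_gt ((C + 2 * c) / (ε / 2))
  refine ⟨(N + 1) ^ 2, fun T hT => ?_⟩
  have hNK : N + 1 ≤ T.sqrt := Nat.le_sqrt'.2 hT
  have hKT : ((T.sqrt : ℕ) : ℝ) ^ 2 ≤ T := by exact_mod_cast Nat.sqrt_le' T
  have hT0 : (0 : ℝ) < T := by
    have : 0 < (N + 1) ^ 2 := by positivity
    exact_mod_cast this.trans_le hT
  generalize T.sqrt = K at hNK hKT ⊢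
  have hNK' : (N : ℝ) < K := by exact_mod_cast hNK
  have hsum : ∑ j ∈ Finset.range K, r j ≤ ε / 2 * K ^ 2 + C * K := by
    clear hNK hKT hNK'
    induction K with
    | zero => simp
    | succ K ih =>
      rw [Finset.sum_range_succ]
      push_cast
      nlinarith [hCr K]
  have h0 : 0 ≤ ∑ j ∈ Finset.range K, r j + 2 * c * K :=
    add_nonneg (Finset.sum_nonneg fun _ _ => hr _) (by positivity)
  rw [Real.dist_eq, sub_zero, abs_of_nonneg (by positivity), div_lt_iff₀ hT0]
  have h1 : C + 2 * c < ε / 2 * K := by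
    have := hN.trans hNK'
    rwa [div_lt_iff₀' (by positivity)] at this
  have hK0 : (0 : ℝ) < K := lt_of_le_of_lt (Nat.cast_nonneg N) hNK'
  nlinarith [mul_lt_mul_of_pos_right h1 hK0]

theorem onlineLearnable_of_SMdim_ne_top (hP : ∀ γ : ℝ, 0 < γ → P.SMdim γ ≠ ⊤) :
    P.OnlineLearnable := by
  have hc := P.c_pos
  choose B hB using fun k : ℕ => P.exists_learner_le_upperBound (T := 2 * k + 1) (by omega)
  have hnn : ∀ n, 0 ≤ P.upperBound n := fun n =>
    le_iInf₂ fun γ hγ => le_iInf₂ fun d _ => EReal.coe_nonneg.2 (by positivity)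
  have hfin : ∀ n, 0 < n → P.upperBound n = ((P.upperBound n).toReal : EReal) := by
    intro n hn
    obtain ⟨C, -, hC⟩ := P.exists_upperBound_le hP one_pos
    exact (EReal.coe_toReal (ne_top_of_le_ne_top (EReal.coe_ne_top _) (hC n hn))
      (ne_bot_of_le_ne_bot (by simp) (hnn n))).symm
  set r : ℕ → ℝ := fun k => (P.upperBound (2 * k + 1)).toReal with hr
  have hr0 : ∀ k, 0 ≤ r k := fun k => EReal.toReal_nonneg (hnn _)
  refine ⟨restart B, fun T => ∑ j ∈ Finset.range T.sqrt, r j + 2 * P.c * T.sqrt,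
    fun T => add_nonneg (Finset.sum_nonneg fun _ _ => hr0 _) (by positivity), ?_,
    tendsto_sum_sqrt_div hr0 hc.le ?_, P.expRegret_restart_le B r ?_⟩
  · intro S T hST
    have h := Nat.sqrt_le_sqrt hST
    refine add_le_add (Finset.sum_le_sum_of_subset_of_nonneg (Finset.range_mono h)
      fun _ _ _ => hr0 _) (mul_le_mul_of_nonneg_left (Nat.cast_le.2 h) (by positivity))
  · intro ε hε
    obtain ⟨C, hC0, hC⟩ := P.exists_upperBound_le hP hε
    refine ⟨C, hC0, fun k => ?_⟩
    have h := hC (2 * k + 1) (by omega)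
    rw [hfin _ (by omega), EReal.coe_le_coe_iff] at h
    push_cast at h
    exact h
  · intro k s
    have h := hB k s
    rw [hfin _ (by omega), EReal.coe_le_coe_iff] at h
    exact h

theorem SMdim_ne_top_of_onlineLearnable (hP : P.OnlineLearnable) {γ : ℝ} (hγ : 0 < γ) :
    P.SMdim γ ≠ ⊤ := by
  intro htop
  obtain ⟨A, R, -, -, hR, hA⟩ := hP
  obtain ⟨n, hn, hn0⟩ := ((hR.eventually_lt_const hγ).and (eventually_gt_atTop 0)).exists
  obtain ⟨s, hs⟩ := P.exists_stream_of_le_SMdim (γ := γ) (n := n) (by simp [htop]) A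
  have hn0' : (0 : ℝ) < n := Nat.cast_pos.2 hn0
  rw [div_lt_iff₀ hn0'] at hn
  linarith [hA n s]

/-! ### The dimension of product classes -/

/-- `U` contains the points at which `V` is not yet constant. Querying one of them against the μ of
`hP` fixes its value and removes it from `U`; at any other point the Dirac measure at the common
value cannot be beaten. -/
lemma TreeShatters.le_card {γ : ℝ} (hγ : 0 < γ)
    (hP : ∀ x, ∃ μ, ∀ y, ∀ h ∈ P.H, ∀ h' ∈ P.H, P.loss y (h x) + γ ≤ P.expLoss y μ →
      P.loss y (h' x) + γ ≤ P.expLoss y μ → h x = h' x)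
    {n : ℕ} {V : Set (X → Z)} (hV : V ⊆ P.H) (U : Finset X)
    (hU : ∀ x, x ∉ U → ∀ h ∈ V, ∀ h' ∈ V, h x = h' x) (hn : P.TreeShatters γ n V) :
    n ≤ U.card := by
  classical
  induction n generalizing U V with
  | zero => exact Nat.zero_le _
  | succ n ih =>
    obtain ⟨g, hg⟩ := hn.nonempty
    obtain ⟨x, hx⟩ := hn
    by_cases hxU : x ∈ U
    · obtain ⟨μ, hμ⟩ := hP x
      obtain ⟨y, hy⟩ := hx μ
      have := ih (fun h hh => hV hh.1) (U.erase x) (fun x' hx' h hh h' hh' => by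
        by_cases hxx : x' = x
        · subst hxx
          exact hμ y h (hV hh.1) h' (hV hh'.1) hh.2 hh'.2
        · exact hU x' (fun hmem => hx' (Finset.mem_erase.2 ⟨hxx, hmem⟩)) h hh.1 h' hh'.1) hy
      rw [Finset.card_erase_of_mem hxU] at this
      have := Finset.card_pos.2 ⟨x, hxU⟩
      omega
    · obtain ⟨y, hy⟩ := hx (diracProba (g x))
      obtain ⟨h, hh, hle⟩ := hy.nonempty
      rw [expLoss_dirac, hU x hxU h hh g hg] at hle
      linarith

/-- Query each point of `U` once. The answer prescribes a value in `S` there and leaves the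
remaining points free; `g` records the values fixed so far. -/
lemma treeShatters_card {γ : ℝ} {S : Set Z}
    (hS : ∀ μ, ∃ y, ∃ v ∈ S, P.loss y v + γ ≤ P.expLoss y μ) (U : Finset X) (g : X → Z)
    {V : Set (X → Z)} (hV : ∀ h : X → Z, (∀ x ∈ U, h x ∈ S) → (∀ x, x ∉ U → h x = g x) → h ∈ V)
    (hg : ∀ x ∈ U, g x ∈ S) : P.TreeShatters γ U.card V := by
  classical
  induction U using Finset.induction_on generalizing g V with
  | empty => exact ⟨g, hV g (by simp) fun _ _ => rfl⟩
  | insert x U hxU ih =>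
    rw [Finset.card_insert_of_notMem hxU]
    refine ⟨x, fun μ => ?_⟩
    obtain ⟨y, v, hv, hle⟩ := hS μ
    refine ⟨y, ih (Function.update g x v) (fun h h1 h2 => ?_) fun x' hx' => ?_⟩
    · have hx : h x = v := by rw [h2 x hxU, Function.update_self]
      refine ⟨hV h (fun x' hx' => ?_) fun x' hx' => ?_, by rwa [hx]⟩
      · rcases Finset.mem_insert.1 hx' with rfl | hx'
        · rwa [hx]
        · exact h1 x' hx'
      · rw [Finset.mem_insert, not_or] at hx'
        rw [h2 x' hx'.2, Function.update_of_ne hx'.1]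
    · have hne : x' ≠ x := fun e => hxU (e ▸ hx')
      rw [Function.update_of_ne hne]
      exact hg x' (Finset.mem_insert_of_mem hx')

lemma SMdim_le_of_forall {γ : ℝ} {d : ℕ} (h : ∀ n, P.TreeShatters γ n P.H → n ≤ d) :
    P.SMdim γ ≤ d :=
  iSup₂_le fun n hn => Nat.cast_le.2 (h n (P.shatters_iff_treeShatters.1 hn))

lemma lowerBound_le {d : ℕ} (hd : ∀ γ : ℝ, 0 < γ → P.SMdim γ ≤ d) :
    P.lowerBound ≤ ENNReal.ofReal P.c * d := by
  refine iSup₂_le fun γ hγ => ?_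
  have hle : (P.SMdim γ : ℝ≥0∞) ≤ (d : ℝ≥0∞) := by exact_mod_cast hd γ hγ
  rcases eq_or_ne (P.SMdim γ) 0 with h0 | h0
  · simp [h0]
  · have h1 : P.TreeShatters γ 1 P.H :=
      P.coe_le_SMdim_iff.1 (by simpa using Order.one_le_iff_pos.2 (pos_iff_ne_zero.2 h0))
    obtain ⟨h, -⟩ := P.H_nonempty
    obtain ⟨x, hx⟩ := h1
    obtain ⟨y, h, -, hy⟩ := hx (diracProba (h x))
    refine mul_le_mul' (ENNReal.ofReal_le_ofReal ?_) hle
    linarith [P.loss_nonneg y (h x), hy.trans (P.expLoss_le y _)]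

lemma _root_.Finset.sum_eq_sum_add_of_eq_off {ι : Type*} [Fintype ι] (f g : ι → ℝ) (i : ι)
    (h : ∀ j, j ≠ i → f j = g j) : ∑ j, f j = ∑ j, g j + (f i - g i) := by
  classical
  have : ∑ j, (f j - g j) = f i - g i :=
    Finset.sum_eq_single i (fun j _ hj => by rw [h j hj, sub_self]) (by simp)
  rw [Finset.sum_sub_distrib] at this
  linarith

/-! ### A class on which the lower bound is attained -/

/-- Binary classification on `d` points, where the learner has a copy of each of the two predictions
for which a mistake is cheaper than for the hypotheses. -/
def cheapMistakes (d : ℕ) : LearningProblem (Fin d) Bool (Bool × Bool) where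
  H := {h | ∀ x, (h x).2 = false}
  loss y z := if y = z.1 then 0 else if z.2 then 1 else 2
  c := 2
  H_nonempty := ⟨fun _ => (false, false), fun _ => rfl⟩
  loss_measurable _ := measurable_of_finite _
  loss_nonneg y z := by split_ifs <;> norm_num
  c_pos := two_pos
  loss_le y z := by split_ifs <;> norm_num

lemma cheapMistakes_SMdim_le (d : ℕ) {γ : ℝ} (hγ : 0 < γ) : (cheapMistakes d).SMdim γ ≤ d := by
  refine SMdim_le_of_forall _ fun n hn => ?_
  have := TreeShatters.le_card _ hγ ?_ le_rfl Finset.univ (fun x hx => by simp at hx) hn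
  · simpa using this
  · intro x
    refine ⟨(diracProba (true, true)), fun y h hh h' hh' h1 h2 => ?_⟩
    have key : ∀ g ∈ (cheapMistakes d).H, (cheapMistakes d).loss y (g x) + γ
        ≤ (cheapMistakes d).expLoss y (diracProba (true, true)) →
        y = (g x).1 := by
      intro g hg hle
      by_contra hne
      have h3 : (cheapMistakes d).loss y (g x) = 2 := by
        simp [cheapMistakes, hne, show (g x).2 = false from hg x]
      have h4 := hle.trans (expLoss_le _ _ _)
      rw [h3] at h4
      have : (cheapMistakes d).c = 2 := rfl
      linarith
    exact Prod.ext ((key h hh h1).symm.trans (key h' hh' h2)) ((hh x).trans (hh' x).symm)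

lemma cheapMistakes_le_SMdim (d : ℕ) : (d : ℕ∞) ≤ (cheapMistakes d).SMdim (1 / 2) := by
  rw [coe_le_SMdim_iff]
  have := (cheapMistakes d).treeShatters_card (γ := 1 / 2) (S := {z | z.2 = false})
    (V := (cheapMistakes d).H) ?_ Finset.univ
    (fun _ => (false, false)) (fun h h1 _ x => h1 x (Finset.mem_univ x)) (fun _ _ => rfl)
  · simpa using this
  · intro μ
    have hsum : 1 ≤ (cheapMistakes d).expLoss true μ + (cheapMistakes d).expLoss false μ := by
      rw [expLoss, expLoss, ← integral_add (integrable_loss _ _ _) (integrable_loss _ _ _)]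
      calc (1 : ℝ) = ∫ _, 1 ∂(μ : Measure (Bool × Bool)) := by simp
        _ ≤ _ := integral_mono (integrable_const _)
          ((integrable_loss _ _ _).add (integrable_loss _ _ _)) fun z => by
            obtain ⟨a, b⟩ := z
            cases a <;> cases b <;> norm_num [cheapMistakes]
    have h0 : ∀ b : Bool, (cheapMistakes d).loss b (b, false) = 0 := fun b => by
      simp [cheapMistakes]
    rcases le_total (1 / 2) ((cheapMistakes d).expLoss true μ) with h | h
    · exact ⟨true, (true, false), rfl, by rw [h0]; linarith⟩
    · exact ⟨false, (false, false), rfl, by rw [h0]; linarith⟩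

/-- The sign of a binary label. -/
def labelSign (b : Bool) : ℤ := if b then 1 else -1

/-- The number of labels `true` minus the number of labels `false` at `x` in a history. -/
def balance {d : ℕ} (l : List (Fin d × Bool)) (x : Fin d) : ℤ :=
  (l.map fun a => if a.1 = x then labelSign a.2 else 0).sum

lemma balance_append {d : ℕ} (l : List (Fin d × Bool)) (a : Fin d × Bool) (x : Fin d) :
    balance (l ++ [a]) x = balance l x + if a.1 = x then labelSign a.2 else 0 := by
  simp [balance]

/-- The uniform mixture of the two cheap predictions. -/
noncomputable def coin : ProbabilityMeasure (Bool × Bool) :=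
  mixture (fun _ : Bool => 1 / 2) (fun _ => by norm_num) (by norm_num)
    fun b => (diracProba (b, true))

/-- Predict the majority label at the current instance, by the cheap prediction. -/
noncomputable def majority (d : ℕ) : OnlineLearner (Fin d) Bool (Bool × Bool) := fun l x =>
  if 0 < balance l x then (diracProba (true, true))
  else if balance l x < 0 then (diracProba (false, true))
  else coin

/-- The largest regret at one instance with respect to a label that is ahead by `k`. -/
noncomputable def leadPotential (k : ℤ) : ℝ := if 0 < k then 1 / 2 else k

lemma leadPotential_le (k : ℤ) : leadPotential k ≤ 1 / 2 := by
  unfold leadPotential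
  split_ifs with h
  · exact le_rfl
  · have : (k : ℝ) ≤ 0 := by exact_mod_cast not_lt.1 h
    linarith

/-- One-round inequality for the lead of the label b. While b trails, a label b costs the learner 1
and raises the potential by 1. At a tie the coin costs 1/2, which is the jump to the cap if b
occurs. While b leads, a mistake costs the learner 1 but the hypothesis 2. -/
lemma expLoss_majority_le (d : ℕ) (l : List (Fin d × Bool)) (x : Fin d) (y b : Bool) :
    (cheapMistakes d).expLoss y (majority d l x) + leadPotential (labelSign b * balance l x)
      ≤ (cheapMistakes d).loss y (b, false)
        + leadPotential (labelSign b * (balance l x + labelSign y)) := by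
  have hcoin : (cheapMistakes d).expLoss y coin = 1 / 2 := by
    rw [coin, expLoss_mixture]
    simp only [expLoss_dirac, Fintype.sum_bool]
    cases y <;> norm_num [cheapMistakes]
  unfold majority
  generalize balance l x = k
  rcases lt_trichotomy k 0 with hk | rfl | hk
  · rw [if_neg hk.not_gt, if_pos hk, expLoss_dirac]
    have hk' : (k : ℝ) ≤ -1 := by exact_mod_cast Int.le_sub_one_of_lt hk
    cases y <;> cases b <;> simp [cheapMistakes, labelSign, leadPotential] <;> split_ifs <;>
      first | omega | linarith
  · rw [if_neg (lt_irrefl _), if_neg (lt_irrefl _), hcoin]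
    cases y <;> cases b <;> norm_num [cheapMistakes, labelSign, leadPotential]
  · rw [if_pos hk, expLoss_dirac]
    have hk' : (1 : ℝ) ≤ k := by exact_mod_cast hk
    cases y <;> cases b <;> simp [cheapMistakes, labelSign, leadPotential] <;> split_ifs <;>
      first | omega | linarith

lemma cumLoss_majority_le (d : ℕ) {h : Fin d → Bool × Bool} (hh : h ∈ (cheapMistakes d).H)
    {T : ℕ} (l : List (Fin d × Bool)) (s : Fin T → Fin d × Bool) :
    (cheapMistakes d).cumLoss (fun l' => majority d (l ++ l')) s
        + ∑ x, leadPotential (labelSign (h x).1 * balance l x)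
      ≤ (cheapMistakes d).hypLoss h s + d / 2 := by
  induction T generalizing l with
  | zero =>
    rw [cumLoss_zero, hypLoss_zero, zero_add, zero_add]
    calc _ ≤ ∑ _x : Fin d, (1 / 2 : ℝ) := Finset.sum_le_sum fun _ _ => leadPotential_le _
      _ = d / 2 := by simp; ring
  | succ T ih =>
    have h1 := ih (l ++ [s 0]) fun t => s t.succ
    rw [cumLoss_succ, hypLoss_succ]
    have h2 := Finset.sum_eq_sum_add_of_eq_off
      (fun x => leadPotential (labelSign (h x).1 * balance (l ++ [s 0]) x))
      (fun x => leadPotential (labelSign (h x).1 * balance l x)) (s 0).1 fun x hx => by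
        rw [balance_append, if_neg (Ne.symm hx), add_zero]
    have h3 := expLoss_majority_le d l (s 0).1 (s 0).2 (h (s 0).1).1
    have h4 : ((h (s 0).1).1, false) = h (s 0).1 := Prod.ext rfl (hh _).symm
    rw [h4] at h3
    simp only [balance_append, if_true] at h2
    simp only [List.append_assoc, List.singleton_append, balance_append] at h1
    simp only [List.append_nil]
    linarith

theorem exists_learner_le_lowerBound (d : ℕ) (hd : 0 < d) :
    ∃ (X Y Z : Type) (_ : MeasurableSpace Z) (P : LearningProblem X Y Z),
      (⨆ (γ : ℝ) (_ : 0 < γ), P.SMdim γ) = (d : ℕ∞) ∧ P.lowerBound ≠ ⊤ ∧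
      ∃ A : OnlineLearner X Y Z, ∀ (T : ℕ) (s : Fin T → X × Y),
        ((P.expRegret A s : ℝ) : EReal) ≤ (P.lowerBound : EReal) := by
  refine ⟨Fin d, Bool, Bool × Bool, inferInstance, cheapMistakes d,
    le_antisymm (iSup₂_le fun γ hγ => cheapMistakes_SMdim_le d hγ)
      (le_iSup₂_of_le (1 / 2) (by norm_num) (cheapMistakes_le_SMdim d)),
    ne_top_of_le_ne_top (ENNReal.mul_ne_top ENNReal.ofReal_ne_top (ENNReal.natCast_ne_top d))
      (lowerBound_le _ fun γ hγ => cheapMistakes_SMdim_le d hγ), majority d, fun T s => ?_⟩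
  have hR : (cheapMistakes d).expRegret (majority d) s ≤ d / 2 :=
    expRegret_le _ fun h hh => by
      have := cumLoss_majority_le d hh [] s
      simpa [balance, leadPotential] using this
  have hL : ENNReal.ofReal (d / 2) ≤ (cheapMistakes d).lowerBound := by
    refine le_iSup₂_of_le (1 / 2) (by norm_num) ?_
    rw [div_eq_mul_one_div, mul_comm, ENNReal.ofReal_mul (by norm_num), ENNReal.ofReal_natCast]
    refine mul_le_mul' le_rfl ?_
    exact_mod_cast cheapMistakes_le_SMdim d
  calc (((cheapMistakes d).expRegret (majority d) s : ℝ) : EReal) ≤ ((d / 2 : ℝ) : EReal) :=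
        EReal.coe_le_coe_iff.2 hR
    _ = ((ENNReal.ofReal (d / 2) : ℝ≥0∞) : EReal) := by
        rw [EReal.coe_ennreal_ofReal, max_eq_left (by positivity)]
    _ ≤ _ := EReal.coe_ennreal_le_coe_ennreal_iff.2 hL

/-! ### Tightness of the upper bound -/

/-- All sign-valued functions on `d` points, with the absolute loss on `[-1, 1]`. -/
noncomputable def signClass (d : ℕ) :
    LearningProblem (Fin d) (Set.Icc (-1 : ℝ) 1) (Set.Icc (-1 : ℝ) 1) where
  H := {h | ∀ x, (h x : ℝ) = 1 ∨ (h x : ℝ) = -1}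
  loss y z := |(y : ℝ) - z|
  c := 2
  H_nonempty := ⟨fun _ => ⟨1, by norm_num⟩, fun _ => Or.inl rfl⟩
  loss_measurable y := by fun_prop
  loss_nonneg y z := abs_nonneg _
  c_pos := two_pos
  loss_le y z := by
    rw [abs_le]
    constructor <;> linarith [y.2.1, y.2.2, z.2.1, z.2.2]

/-- The label `1`. -/
def posLabel : Set.Icc (-1 : ℝ) 1 := ⟨1, by norm_num⟩

/-- The label `-1`. -/
def negLabel : Set.Icc (-1 : ℝ) 1 := ⟨-1, by norm_num⟩

lemma signClass_expLoss_add (d : ℕ) (μ : ProbabilityMeasure (Set.Icc (-1 : ℝ) 1)) :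
    (signClass d).expLoss posLabel μ + (signClass d).expLoss negLabel μ = 2 := by
  rw [expLoss, expLoss, ← integral_add (integrable_loss _ _ _) (integrable_loss _ _ _)]
  have : ∀ z, (signClass d).loss posLabel z + (signClass d).loss negLabel z = 2 := fun z => by
    show |(1 : ℝ) - z| + |(-1 : ℝ) - z| = 2
    rw [abs_of_nonneg (by linarith [z.2.2]), abs_of_nonpos (by linarith [z.2.1])]
    ring
  simp [this]

/-- Only the sign agreeing with y can be strictly closer to y than the prediction 0. -/
lemma signClass_SMdim_le (d : ℕ) {γ : ℝ} (hγ : 0 < γ) : (signClass d).SMdim γ ≤ d := by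
  refine SMdim_le_of_forall _ fun n hn => ?_
  have := TreeShatters.le_card _ hγ ?_ le_rfl Finset.univ (fun x hx => by simp at hx) hn
  · simpa using this
  · intro x
    refine ⟨diracProba ⟨0, by norm_num⟩, fun y h hh h' hh' h1 h2 => ?_⟩
    rw [expLoss_dirac] at h1 h2
    change |(y : ℝ) - h x| + γ ≤ |(y : ℝ) - 0| at h1
    change |(y : ℝ) - h' x| + γ ≤ |(y : ℝ) - 0| at h2
    refine Subtype.ext ?_
    rw [sub_zero] at h1 h2
    rcases hh x with e | e <;> rcases hh' x with e' | e' <;> rw [e] at h1 ⊢ <;>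
      rw [e'] at h2 ⊢ <;> exfalso <;>
      rcases abs_cases (y : ℝ) with ⟨h3, _⟩ | ⟨h3, _⟩ <;>
      linarith [le_abs_self ((y : ℝ) - 1), neg_abs_le ((y : ℝ) - 1),
        le_abs_self ((y : ℝ) - -1), neg_abs_le ((y : ℝ) - -1)]

lemma signClass_le_SMdim (d : ℕ) : (d : ℕ∞) ≤ (signClass d).SMdim 1 := by
  rw [coe_le_SMdim_iff]
  have := (signClass d).treeShatters_card (γ := 1) (S := {z | (z : ℝ) = 1 ∨ (z : ℝ) = -1})
    (V := (signClass d).H) ?_ Finset.univ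
    (fun _ => posLabel) (fun h h1 _ x => h1 x (Finset.mem_univ x)) (fun _ _ => Or.inl rfl)
  · simpa using this
  · intro μ
    have hsum := signClass_expLoss_add d μ
    have h0 : ∀ b, (signClass d).loss b b = 0 := fun b => by simp [signClass]
    rcases le_total 1 ((signClass d).expLoss posLabel μ) with h | h
    · exact ⟨posLabel, posLabel, Or.inl rfl, by rw [h0]; linarith⟩
    · exact ⟨negLabel, negLabel, Or.inr rfl, by rw [h0]; linarith⟩

/-- The expectation of `3 / 2 * R ^ 2 / c - R ^ 4 / (2 * c ^ 3)`, a lower bound for `|R|`, where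
`R` is the position after `m` steps of the simple random walk that starts in `S`. -/
noncomputable def walkPotential (c m S : ℝ) : ℝ :=
  3 / 2 * (S ^ 2 + m) / c - (S ^ 4 + 6 * m * S ^ 2 + 3 * m ^ 2 - 2 * m) / (2 * c ^ 3)

/-- The potential is a martingale along the simple random walk, which is all the adversary needs
from probability. -/
lemma walkPotential_step (c m S : ℝ) :
    walkPotential c (m - 1) (S + 1) + walkPotential c (m - 1) (S + -1)
      = 2 * walkPotential c m S := by
  unfold walkPotential
  ring

lemma walkPotential_zero_le {c : ℝ} (hc : 0 < c) (S : ℝ) : walkPotential c 0 S ≤ |S| := by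
  have e : walkPotential c 0 S = 3 / 2 * |S| ^ 2 / c - |S| ^ 4 / (2 * c ^ 3) := by
    rw [walkPotential, sq_abs, show |S| ^ 4 = S ^ 4 from Even.pow_abs (by decide) S]
    ring
  rw [e]
  have hu := abs_nonneg S
  generalize |S| = u at hu ⊢
  -- The quartic touches u from below at u = c, hence the double root.
  have h : u - (3 / 2 * u ^ 2 / c - u ^ 4 / (2 * c ^ 3))
      = u * (u - c) ^ 2 * (u + 2 * c) / (2 * c ^ 3) := by
    field_simp
    ring
  have : 0 ≤ u * (u - c) ^ 2 * (u + 2 * c) / (2 * c ^ 3) := by positivity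
  linarith

/-- How often `x` occurs in a finite sequence. -/
noncomputable def occurrences {d T : ℕ} (xs : Fin T → Fin d) (x : Fin d) : ℝ :=
  ∑ t, if xs t = x then 1 else 0

/-- `S x` is the sum of the past labels at x. Over the labels ±1 the learner's loss averages to 1
and the potential is preserved, so one of the two labels is good enough. As |y - h| = 1 - h y for
signs, the final hypothesis is the sign of `S`. -/
lemma exists_adversary (d : ℕ) {c : ℝ} (hc : 0 < c) {T : ℕ} (xs : Fin T → Fin d)
    (S : Fin d → ℝ) (A : OnlineLearner (Fin d) (Set.Icc (-1 : ℝ) 1) (Set.Icc (-1 : ℝ) 1)) :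
    ∃ s : Fin T → Fin d × Set.Icc (-1 : ℝ) 1, ∃ h ∈ (signClass d).H,
      ∑ x, walkPotential c (occurrences xs x) (S x)
        ≤ (signClass d).cumLoss A s - (signClass d).hypLoss h s + ∑ x, (h x : ℝ) * S x := by
  induction T generalizing S A with
  | zero =>
    refine ⟨Fin.elim0, fun x => if 0 ≤ S x then posLabel else negLabel, fun x => ?_, ?_⟩
    · by_cases hx : 0 ≤ S x
      · left; simp [hx, posLabel]
      · right; simp [hx, negLabel]
    · rw [cumLoss_zero, hypLoss_zero, sub_zero, zero_add]
      refine Finset.sum_le_sum fun x _ => ?_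
      have h0 : occurrences xs x = 0 := by simp [occurrences]
      rw [h0]
      refine (walkPotential_zero_le hc _).trans (le_of_eq ?_)
      by_cases hx : 0 ≤ S x
      · simp [hx, posLabel, abs_of_nonneg hx]
      · simp [hx, negLabel, abs_of_neg (not_le.1 hx)]
  | succ T ih =>
    set x := xs 0 with hx
    set m := occurrences xs x with hm
    have hocc : ∀ x', occurrences xs x'
        = (if x = x' then 1 else 0) + occurrences (fun t => xs t.succ) x' := fun x' => by
      rw [occurrences, Fin.sum_univ_succ, ← hx, occurrences]
    obtain ⟨y, hy, hstep⟩ : ∃ y : Set.Icc (-1 : ℝ) 1, ((y : ℝ) = 1 ∨ (y : ℝ) = -1) ∧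
        walkPotential c m (S x) ≤ (signClass d).expLoss y (A [] x) - 1
          + walkPotential c (m - 1) (S x + y) := by
      have h1 := signClass_expLoss_add d (A [] x)
      have h2 := walkPotential_step c m (S x)
      by_contra! hcon
      have h3 := hcon posLabel (Or.inl rfl)
      have h4 := hcon negLabel (Or.inr rfl)
      have e3 : (posLabel : ℝ) = 1 := rfl
      have e4 : (negLabel : ℝ) = -1 := rfl
      rw [e3] at h3
      rw [e4] at h4
      linarith
    obtain ⟨s, h, hh, hs⟩ := ih (fun t => xs t.succ) (Function.update S x (S x + y))
      fun l => A ((x, y) :: l)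
    refine ⟨Fin.cons (x, y) s, h, hh, ?_⟩
    rw [cumLoss_succ, hypLoss_succ]
    simp only [Fin.cons_zero, Fin.cons_succ]
    have h1 := Finset.sum_eq_sum_add_of_eq_off
      (fun x' => walkPotential c (occurrences xs x') (S x'))
      (fun x' => walkPotential c (occurrences (fun t => xs t.succ) x')
        (Function.update S x (S x + y) x')) x fun x' hx' => by
          rw [hocc, if_neg (Ne.symm hx'), zero_add, Function.update_of_ne hx']
    have h2 := Finset.sum_eq_sum_add_of_eq_off
      (fun x' => (h x' : ℝ) * Function.update S x (S x + y) x')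
      (fun x' => (h x' : ℝ) * S x') x fun x' hx' => by rw [Function.update_of_ne hx']
    simp only [Function.update_self] at h1 h2
    have h3 : occurrences (fun t => xs t.succ) x = m - 1 := by
      have := hocc x
      rw [if_pos rfl] at this
      linarith
    have h4 : (signClass d).loss y (h x) = 1 - (h x : ℝ) * y := by
      show |(y : ℝ) - h x| = _
      rcases hy with e | e <;> rcases hh x with e' | e' <;> rw [e, e'] <;> norm_num
    rw [h3] at h1
    rw [h4]
    linarith

lemma occurrences_mod_le {d : ℕ} (hd : 0 < d) (T : ℕ) (x : Fin d) :
    occurrences (fun t : Fin T => (⟨t % d, Nat.mod_lt _ hd⟩ : Fin d)) x ≤ T / d + 1 := by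
  have h1 : occurrences (fun t : Fin T => (⟨t % d, Nat.mod_lt _ hd⟩ : Fin d)) x
      = (Nat.count (· ≡ x [MOD d]) T : ℕ) := by
    rw [occurrences, Nat.count_eq_card_filter_range, Finset.card_filter, Finset.sum_range]
    push_cast
    refine Finset.sum_congr rfl fun t _ => ?_
    simp only [Fin.ext_iff, Nat.ModEq, Nat.mod_eq_of_lt x.2]
  rw [h1, Nat.count_modEq_card _ hd]
  have h2 : ((T / d : ℕ) : ℝ) ≤ T / d := Nat.cast_div_le
  push_cast
  split_ifs <;> simp <;> linarith

lemma sum_occurrences {d T : ℕ} (xs : Fin T → Fin d) : ∑ x, occurrences xs x = T := by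
  simp only [occurrences]
  rw [Finset.sum_comm]
  simp

lemma exists_stream_sqrt_le {d T : ℕ} (hd : 0 < d) (hdT : d ≤ T)
    (A : OnlineLearner (Fin d) (Set.Icc (-1 : ℝ) 1) (Set.Icc (-1 : ℝ) 1)) :
    ∃ s : Fin T → Fin d × Set.Icc (-1 : ℝ) 1,
      3 / 8 * √(d * T) ≤ (signClass d).expRegret A s := by
  have hd' : (0 : ℝ) < d := Nat.cast_pos.2 hd
  have hT' : (0 : ℝ) < T := Nat.cast_pos.2 (hd.trans_le hdT)
  set a := √(T : ℝ)
  set b := √(d : ℝ)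
  have ha : 0 < a := Real.sqrt_pos.2 hT'
  have hb : 0 < b := Real.sqrt_pos.2 hd'
  have ha2 : a ^ 2 = T := Real.sq_sqrt hT'.le
  have hb2 : b ^ 2 = d := Real.sq_sqrt hd'.le
  -- Cycling through the points visits each at most T/d + 1 ≤ 2T/d = c²/2 times, so the
  -- fourth-moment term takes away at most half of the second-moment term.
  set c := 2 * a / b with hc
  have hc0 : 0 < c := by positivity
  set xs : Fin T → Fin d := fun t => ⟨t % d, Nat.mod_lt _ hd⟩
  obtain ⟨s, h, hh, hs⟩ := exists_adversary d hc0 xs (fun _ => 0) A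
  refine ⟨s, le_trans ?_ (cumLoss_sub_hypLoss_le _ A s hh)⟩
  simp only [mul_zero, Finset.sum_const_zero, add_zero] at hs
  refine le_trans ?_ hs
  have hone : ∀ x, 3 / 4 / c * occurrences xs x ≤ walkPotential c (occurrences xs x) 0 := by
    intro x
    have h0 : 0 ≤ occurrences xs x := Finset.sum_nonneg fun _ _ => by split_ifs <;> norm_num
    have h1 : occurrences xs x ≤ c ^ 2 / 2 := by
      have h2 := occurrences_mod_le hd T x
      have h3 : (1 : ℝ) ≤ T / d := (one_le_div hd').2 (Nat.cast_le.2 hdT)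
      have h4 : c ^ 2 / 2 = 2 * (T / d) := by rw [hc, div_pow, mul_pow, ha2, hb2]; ring
      rw [h4]
      exact h2.trans (by linarith)
    generalize occurrences xs x = m at h0 h1 ⊢
    have e : walkPotential c m 0 - 3 / 4 / c * m
        = (3 * m * (c ^ 2 / 2 - m) + 2 * m) / (2 * c ^ 3) := by
      unfold walkPotential
      field_simp
      ring
    have : 0 ≤ (3 * m * (c ^ 2 / 2 - m) + 2 * m) / (2 * c ^ 3) := by
      have := sub_nonneg.2 h1
      positivity
    linarith
  calc 3 / 8 * √(d * T) = 3 / 4 / c * T := by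
        have e : √(d * T : ℝ) = b * a := Real.sqrt_mul hd'.le _
        rw [e, hc, ← ha2]
        field_simp
        ring
    _ = ∑ x, 3 / 4 / c * occurrences xs x := by rw [← Finset.mul_sum, sum_occurrences]
    _ ≤ _ := Finset.sum_le_sum fun x _ => hone x

lemma signClass_upperBound_le {d T : ℕ} (hd : 0 < d) (hT : 2 ≤ T) (hdT : d ≤ T) :
    (signClass d).upperBound T ≤ ((15 * Real.log T * √(d * T) : ℝ) : EReal) := by
  have hT2 : (2 : ℝ) ≤ T := by exact_mod_cast hT
  have hT' : (0 : ℝ) < T := by linarith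
  have hd1 : (1 : ℝ) ≤ d := by exact_mod_cast hd
  have hdT' : (d : ℝ) ≤ T := Nat.cast_le.2 hdT
  have hle := signClass_SMdim_le d (one_div_pos.2 hT')
  obtain ⟨n, hn⟩ := ENat.ne_top_iff_exists.1 (ne_top_of_le_ne_top (ENat.natCast_ne_top d) hle)
  rw [← hn, Nat.cast_le] at hle
  have hnd : (n : ℝ) ≤ d := Nat.cast_le.2 hle
  -- The dimension is at most d at every scale, so γ = 1/T makes γT a constant.
  refine (iInf₂_le_of_le (1 / T : ℝ) (one_div_pos.2 hT') (iInf₂_le_of_le n hn.symm le_rfl)).trans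
    (EReal.coe_le_coe_iff.2 ?_)
  show 2 * (n : ℝ) + 1 / T * T + 1 + 2 * 2 * √(n * T * Real.log (2 * 2 * T))
    ≤ 15 * Real.log T * √(d * T)
  have hlog : 69 / 100 ≤ Real.log T :=
    le_trans (by linarith [Real.log_two_gt_d9]) (Real.log_le_log two_pos hT2)
  have hlog4 : Real.log (2 * 2 * T) ≤ 3 * Real.log T := by
    have : (2 * 2 * T : ℝ) ≤ T ^ 3 := by
      nlinarith [mul_nonneg hT'.le (mul_nonneg (sub_nonneg.2 hT2) (by linarith : (0 : ℝ) ≤ T + 2))]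
    calc Real.log (2 * 2 * T) ≤ Real.log ((T : ℝ) ^ 3) := Real.log_le_log (by positivity) this
      _ = 3 * Real.log T := by rw [Real.log_pow]; norm_num
  have hw1 : (d : ℝ) ≤ √(d * T) := Real.le_sqrt_of_sq_le (by nlinarith)
  have hs : √(n * T * Real.log (2 * 2 * T)) ≤ √(d * T) * ((1 + 3 * Real.log T) / 2) := by
    have h0 : 0 ≤ Real.log (2 * 2 * T) := Real.log_nonneg (by linarith)
    rw [Real.sqrt_mul (by positivity)]
    refine mul_le_mul (Real.sqrt_le_sqrt (by gcongr)) ?_ (Real.sqrt_nonneg _) (Real.sqrt_nonneg _)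
    refine Real.sqrt_le_iff.2 ⟨by linarith, hlog4.trans ?_⟩
    nlinarith [sq_nonneg (1 - 3 * Real.log T)]
  rw [one_div_mul_cancel hT'.ne']
  have hw2 := mul_le_mul_of_nonneg_left hlog (Real.sqrt_nonneg (d * T : ℝ))
  generalize √(d * T : ℝ) = w at hw1 hw2 hs ⊢
  have hs' := hs.trans_eq (show w * ((1 + 3 * Real.log T) / 2)
    = w / 2 + 3 / 2 * (w * Real.log T) by ring)
  have hn2 : 2 * (n : ℝ) + 1 + 1 ≤ 4 * w := by linarith
  have e : 15 * Real.log T * w = 15 * (w * Real.log T) := by ring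
  rw [e]
  generalize √(n * T * Real.log (2 * 2 * T)) = u at hs' ⊢
  linarith only [hn2, hw2, hs', hw1, hd1]

theorem exists_upperBound_tight :
    ∃ C : ℝ, 0 < C ∧ ∀ d : ℕ, 0 < d →
      ∃ (X : Type) (P : LearningProblem X (Set.Icc (-1 : ℝ) 1) (Set.Icc (-1 : ℝ) 1)),
        (∀ y z, P.loss y z = |(y : ℝ) - (z : ℝ)|) ∧ P.c = 2 ∧
        (⨆ (γ : ℝ) (_ : 0 < γ), P.SMdim γ) = (d : ℕ∞) ∧
        ∀ T : ℕ, 2 ≤ T → d ≤ T →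
          ∀ A : OnlineLearner X (Set.Icc (-1 : ℝ) 1) (Set.Icc (-1 : ℝ) 1),
            ∃ s : Fin T → X × Set.Icc (-1 : ℝ) 1,
              P.upperBound T ≤ ((C * Real.log T * P.expRegret A s : ℝ) : EReal) := by
  -- 40 · 3/8 = 15 matches the constants of the two bounds.
  refine ⟨40, by norm_num, fun d hd => ⟨Fin d, signClass d, fun _ _ => rfl, rfl,
    le_antisymm (iSup₂_le fun γ hγ => signClass_SMdim_le d hγ)
      (le_iSup₂_of_le 1 one_pos (signClass_le_SMdim d)), fun T hT hdT A => ?_⟩⟩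
  obtain ⟨s, hs⟩ := exists_stream_sqrt_le hd hdT A
  refine ⟨s, (signClass_upperBound_le hd hT hdT).trans (EReal.coe_le_coe_iff.2 ?_)⟩
  have h0 : 0 ≤ Real.log T := Real.log_natCast_nonneg T
  nlinarith [mul_le_mul_of_nonneg_left hs h0]

end LearningProblem

theorem mainTheorem1 :
    -- (i) upper bound, by one learner for each horizon `T`
    (∀ (X Y Z : Type*) [MeasurableSpace Z] (P : LearningProblem X Y Z) (T : ℕ), 0 < T →
      ∃ A : OnlineLearner X Y Z, ∀ s : Fin T → X × Y,
        ((P.expRegret A s : ℝ) : EReal) ≤ P.upperBound T) ∧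
    -- (i) tightness up to a factor `O(ln T)`, for the absolute loss on `[-1, 1]`, in any dimension
    (∃ C : ℝ, 0 < C ∧ ∀ d : ℕ, 0 < d →
      ∃ (X : Type) (P : LearningProblem X (Set.Icc (-1 : ℝ) 1) (Set.Icc (-1 : ℝ) 1)),
        (∀ y z, P.loss y z = |(y : ℝ) - (z : ℝ)|) ∧ P.c = 2 ∧
        (⨆ (γ : ℝ) (_ : 0 < γ), P.SMdim γ) = (d : ℕ∞) ∧
        ∀ T : ℕ, 2 ≤ T → d ≤ T →
          ∀ A : OnlineLearner X (Set.Icc (-1 : ℝ) 1) (Set.Icc (-1 : ℝ) 1),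
            ∃ s : Fin T → X × Set.Icc (-1 : ℝ) 1,
              P.upperBound T ≤ ((C * Real.log T * P.expRegret A s : ℝ) : EReal)) ∧
    -- (ii) lower bound for every learner
    (∀ (X Y Z : Type*) [MeasurableSpace Z] (P : LearningProblem X Y Z),
      0 < (⨆ (γ : ℝ) (_ : 0 < γ), P.SMdim γ) →
      ∀ A : OnlineLearner X Y Z,
        (∀ γ : ℝ, 0 < γ → ∀ n : ℕ, (n : ℕ∞) ≤ P.SMdim γ →
          ∃ s : Fin n → X × Y, γ * n ≤ P.expRegret A s) ∧
        (∀ r : ℝ, (r : EReal) < (P.lowerBound : EReal) →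
          ∃ T : ℕ, 0 < T ∧ ∃ s : Fin T → X × Y, r < P.expRegret A s)) ∧
    -- (ii) the lower bound is attained exactly by some learner for some tuple, in any dimension
    (∀ d : ℕ, 0 < d →
      ∃ (X Y Z : Type) (_ : MeasurableSpace Z) (P : LearningProblem X Y Z),
        (⨆ (γ : ℝ) (_ : 0 < γ), P.SMdim γ) = (d : ℕ∞) ∧ P.lowerBound ≠ ⊤ ∧
        ∃ A : OnlineLearner X Y Z, ∀ (T : ℕ) (s : Fin T → X × Y),
          ((P.expRegret A s : ℝ) : EReal) ≤ (P.lowerBound : EReal)) ∧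
    -- characterization of learnability
    (∀ (X Y Z : Type*) [MeasurableSpace Z] (P : LearningProblem X Y Z),
      P.OnlineLearnable ↔ ∀ γ : ℝ, 0 < γ → P.SMdim γ ≠ ⊤) := by
  refine ⟨fun X Y Z _ P T hT => P.exists_learner_le_upperBound hT,
    LearningProblem.exists_upperBound_tight, fun X Y Z _ P hP A =>
      ⟨fun γ _ n hn => P.exists_stream_of_le_SMdim hn A, P.exists_stream_of_lt_lowerBound hP A⟩,
    LearningProblem.exists_learner_le_lowerBound, fun X Y Z _ P =>
      ⟨fun hP γ hγ => P.SMdim_ne_top_of_onlineLearnable hP hγ, P.onlineLearnable_of_SMdim_ne_top⟩⟩
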